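/- Let $n\in\mathbb N$ and let $C=C((-\infty,0],\mathbb R^n)$ be the Fréchet space of continuous maps $(-\infty,0]\to\mathbb R^n$ with the topology of locally uniform convergence. **Smoothness.** Let $V,W$ be topological vector spaces, $O\subset V$ open and $g:O\to W$ continuous, and write $Dg(u)v=\lim_{0\ne h\to0}\frac1h\big(g(u+hv)-g(u)\big)$. The map $g$ is *$C^1_{MB}$-smooth* if $Dg(u)v$ exists for all $u\in O$, $v\in V$ and the map $O\times V\ni(u,v)\mapsto Dg(u)v\in W$ is continuous. It is *$C^1_F$-smooth* if all $Dg(u)v$ exist, each $Dg(u):V\to W$ is linear and continuous, and $O\ni u\mapsto Dg(u)\in L_c(V,W)$ is continuous with respect to the topology of uniform convergence on bounded sets on the space $L_c(V,W)$ of continuous linear maps $V\to W$. **Solutions.** Let $U\subset C$ be open and $f:U\to\mathbb R^n$. A solution of $$x'(t)=f(x_t)\qquad(1)$$ on an interval $I\subset\mathbb R$ is a continuous map $x:(-\infty,0]+I\to\mathbb R^n$ such that all segments $x_t:(-\infty,0]\ni s\mapsto x(t+s)\in\mathbb R^n$, $t\in I$, belong to $U$, and $x|_I$ is differentiable and satisfies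 (1) for all $t\in I$ (with one-sided derivatives at endpoints of $I$ belonging to $I$). For $\phi\in U$ let $$t_\phi=\sup\{t>0:\text{there is a solution of (1) on }[0,t]\text{ with }x_0=\phi\}\le\infty .$$ **Corollary 4.3.** Let $*=MB$ or $*=F$, let $U\subset C$ be open, and let $f:U\to\mathbb R^n$ be $C^1_*$-smooth. Then the following hold. 1. For every $\phi\in U$ we have $t_\phi>0$. There is a maximal solution $x^\phi:(-\infty,t_\phi)\to\mathbb R^n$: the equations $x^\phi_0=\phi$ and $x^\phi(t)=x(t)$ for $0<t<t_\phi$, where $x$ is any solution of (1) on some $[0,t']$ with $t<t'<t_\phi$ and $x_0=\phi$, define a solution of (1) on $[0,t_\phi)$. Every solution $y$ of (1) on an interval $I$ of positive length with $\min I=0$ and $y_0=\phi$ is a restriction of $x^\phi$; in particular $I\subset[0,t_\phi)$. 2. Set $\Omega=\{(t,\phi)\in[0,\infty)\times U:t<t_\phi\}$ and $\Sigma(t,\phi)=x^\phi_t$ for $(t,\phi)\in\Omega$. Then $\Sigma$ is a semiflow on $U$: it maps $\Omega$ into $U$; $\{0\}\times U\subset\Omega$ and $\Sigma(0,\phi)=\phi$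 for all $\phi\in U$; and if $(t,\phi)\in\Omega$ and $(s,\Sigma(t,\phi))\in\Omega$, then $(s+t,\phi)\in\Omega$ and $\Sigma(s,\Sigma(t,\phi))=\Sigma(s+t,\phi)$. 3. The semiflow $\Sigma:\Omega\to U$ is continuous. 4. For every $t\ge0$ the set $\Omega_t=\{\phi\in U:(t,\phi)\in\Omega\}$ is open, and the solution operator $\Sigma_t:\Omega_t\to C$, $\Sigma_t(\phi)=\Sigma(t,\phi)$, is $C^1_*$-smooth. -/

import Mathlib

open Set Filter Topology
open scoped Pointwise

namespace FrechetDDE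

/-! ### Continuous differentiability in topological vector spaces -/

section Calculus

variable {V W : Type*} [AddCommGroup V] [Module ℝ V] [TopologicalSpace V]
  [AddCommGroup W] [Module ℝ W] [TopologicalSpace W]

/-- `w` is the directional derivative of `f` at `u` in the direction `v`:
`w = lim_{0 ≠ h → 0} h⁻¹ (f (u + h v) - f u)`. -/
def HasDirectionalDeriv (f : V → W) (u v : V) (w : W) : Prop :=
  Tendsto (fun h : ℝ => h⁻¹ • (f (u + h • v) - f u)) (𝓝[≠] 0) (𝓝 w)

/-- Continuous differentiability on the (open) set `U` in the sense of Michal and Bastiani: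
`f` is continuous on `U`, all directional derivatives `D u v` with `u ∈ U` exist, and
`(u, v) ↦ D u v` is continuous on `U × V`. -/
def IsC1MBOn (f : V → W) (U : Set V) : Prop :=
  ContinuousOn f U ∧
    ∃ D : V → V → W,
      (∀ u ∈ U, ∀ v : V, HasDirectionalDeriv f u v (D u v)) ∧
      ContinuousOn (fun p : V × V => D p.1 p.2) (U ×ˢ univ)

/-- Continuous differentiability on the (open) set `U` in the sense of Fréchet:
`f` is continuous on `U`, all directional derivatives at points `u ∈ U` exist and form a
continuous linear map `D u : V → W`, and `u ↦ D u` is continuous on `U` for the topology of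
uniform convergence on (von Neumann) bounded sets, which is the topology that Mathlib puts on
`V →L[ℝ] W`. -/
def IsC1FOn [IsTopologicalAddGroup W] (f : V → W) (U : Set V) : Prop :=
  ContinuousOn f U ∧
    ∃ D : V → (V →L[ℝ] W),
      (∀ u ∈ U, ∀ v : V, HasDirectionalDeriv f u v (D u v)) ∧
      ContinuousOn D U

/-- The two kinds of continuous differentiability: Michal-Bastiani and Fréchet. -/
inductive C1Kind : Type
  | MB
  | F

/-- `f` is `C¹`-smooth of the given kind on `U`. -/
def IsC1On [IsTopologicalAddGroup W] (kind : C1Kind)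
    (f : V → W) (U : Set V) : Prop :=
  match kind with
  | C1Kind.MB => IsC1MBOn f U
  | C1Kind.F => IsC1FOn f U

end Calculus

/-! ### The delay differential equation `x'(t) = f(x_t)` -/

/-- The Fréchet space `C((-∞, 0], ℝⁿ)`. Its topology in Mathlib is the compact-open topology,
which is the topology of locally uniform convergence. -/
abbrev HistorySpace (n : ℕ) : Type :=
  C(Iic (0 : ℝ), EuclideanSpace ℝ (Fin n))

section DDE

variable {n : ℕ}

open Classical in
/-- The segment `x_t : (-∞, 0] → ℝⁿ`, `x_t s = x (t + s)`, as an element of `C((-∞, 0], ℝⁿ)`.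
It is only used where `x` is continuous on `(-∞, t]`; otherwise the value is `0`. -/
noncomputable def historySegment (x : ℝ → EuclideanSpace ℝ (Fin n)) (t : ℝ) : HistorySpace n :=
  if h : Continuous (fun s : Iic (0 : ℝ) => x (t + s)) then ⟨fun s => x (t + s), h⟩ else 0

/-- `x` is a solution of `x'(t) = f(x_t)` on the interval `I`. Only the values of `x` on
`(-∞, 0] + I` matter: `x` is continuous there, all segments `x_t` with `t ∈ I` belong to `U`, and
the restriction of `x` to `I` is differentiable and satisfies the equation at every `t ∈ I`. -/
def IsSolutionOn (U : Set (HistorySpace n)) (f : HistorySpace n → EuclideanSpace ℝ (Fin n))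
    (I : Set ℝ) (x : ℝ → EuclideanSpace ℝ (Fin n)) : Prop :=
  ContinuousOn x (Iic (0 : ℝ) + I) ∧
    ∀ t ∈ I, historySegment x t ∈ U ∧ HasDerivWithinAt x (f (historySegment x t)) I t

/-- `t_φ ∈ [-∞, ∞]`, the supremum of all `t > 0` for which there is a solution on `[0, t]` with
`x_0 = φ`. -/
noncomputable def escapeTime (U : Set (HistorySpace n))
    (f : HistorySpace n → EuclideanSpace ℝ (Fin n)) (φ : HistorySpace n) : EReal :=
  sSup ((fun t : ℝ => (t : EReal)) ''
    {t : ℝ | 0 < t ∧ ∃ x : ℝ → EuclideanSpace ℝ (Fin n),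
      IsSolutionOn U f (Icc 0 t) x ∧ historySegment x 0 = φ})

/-- The interval `[0, t_φ)`. -/
def maximalInterval (U : Set (HistorySpace n))
    (f : HistorySpace n → EuclideanSpace ℝ (Fin n)) (φ : HistorySpace n) : Set ℝ :=
  {t : ℝ | 0 ≤ t ∧ (t : EReal) < escapeTime U f φ}

open Classical in
/-- The maximal solution `x^φ` on `(-∞, t_φ)`: it equals `φ` on `(-∞, 0]`, and for `0 < t < t_φ`
its value is `x t` for some solution `x` on an interval `[0, t']` with `t < t' < t_φ` and
`x_0 = φ`. The values for `t ≥ t_φ` are irrelevant. -/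
noncomputable def maximalSolution (U : Set (HistorySpace n))
    (f : HistorySpace n → EuclideanSpace ℝ (Fin n)) (φ : HistorySpace n) (t : ℝ) :
    EuclideanSpace ℝ (Fin n) :=
  if h₀ : t ≤ 0 then φ ⟨t, h₀⟩
  else if h : ∃ x : ℝ → EuclideanSpace ℝ (Fin n), ∃ t' : ℝ,
      t < t' ∧ (t' : EReal) < escapeTime U f φ ∧
        IsSolutionOn U f (Icc 0 t') x ∧ historySegment x 0 = φ
    then h.choose t
    else 0

/-- `Ω = {(t, φ) ∈ [0, ∞) × U : t < t_φ}`. -/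
def flowDomain (U : Set (HistorySpace n))
    (f : HistorySpace n → EuclideanSpace ℝ (Fin n)) : Set (ℝ × HistorySpace n) :=
  {p | 0 ≤ p.1 ∧ p.2 ∈ U ∧ (p.1 : EReal) < escapeTime U f p.2}

/-- `Ω_t = {φ ∈ U : (t, φ) ∈ Ω}`. -/
def flowDomainAt (U : Set (HistorySpace n))
    (f : HistorySpace n → EuclideanSpace ℝ (Fin n)) (t : ℝ) : Set (HistorySpace n) :=
  {φ | φ ∈ U ∧ (t, φ) ∈ flowDomain U f}

/-- `Σ(t, φ) = x^φ_t`, of interest for `(t, φ) ∈ Ω`. -/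
noncomputable def flow (U : Set (HistorySpace n))
    (f : HistorySpace n → EuclideanSpace ℝ (Fin n)) (t : ℝ) (φ : HistorySpace n) :
    HistorySpace n :=
  historySegment (maximalSolution U f φ) t

end DDE

/-- `S : Ω → U`, with `Ω ⊆ [0, ∞) × U`, is a semiflow on `U`. -/
structure IsSemiflow {X : Type*} (U : Set X) (Ω : Set (ℝ × X)) (S : ℝ → X → X) : Prop where
  domain_subset : Ω ⊆ Ici 0 ×ˢ U
  mapsTo : ∀ t φ, (t, φ) ∈ Ω → S t φ ∈ U
  zero_mem : ∀ φ ∈ U, (0, φ) ∈ Ω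
  zero_apply : ∀ φ ∈ U, S 0 φ = φ
  add : ∀ s t φ, (t, φ) ∈ Ω → (s, S t φ) ∈ Ω → (s + t, φ) ∈ Ω ∧ S s (S t φ) = S (s + t) φ

end FrechetDDE

/-!
Everything rests on one observation: if `(u, v) ↦ D f(u) v` is continuous, then near a compact set
`K ⊆ U` the derivatives are bounded, and `f` is Lipschitz, with respect to a *single* seminorm
`‖φ‖_T = sup_{[-T, 0]} ‖φ‖` (`exists_isLipschitzTube`). Along the compact orbit of a solution the
equation thus behaves like one with bounded delay, and the usual tools are available: a Gronwall
estimate (`norm_le_gronwallConst`) and a contraction argument in a weighted norm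
(`exists_solution_of_lipschitz`). As Fréchet smooth maps on the Fréchet space of histories are also
smooth in the sense of Michal and Bastiani (`continuousOn_uncurry_of_continuousOn`), this applies to
both kinds of smoothness.

Existence of solutions follows by truncating `f` radially outside a tube around the orbit of a given
curve: the truncated equation is globally Lipschitz, hence solvable, and its solutions solve the
original equation as long as they stay in the tube. Around a constant curve this gives local
existence (`exists_isSol`). Around the orbit of a solution on `[0, a]`, the Gronwall estimate keeps
all solutions with nearby initial history in the tube up to time `a` (`IsSol.exists_nearby`), which
gives open domains and continuity of the semiflow. Since solutions on closed intervals can always be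
extended (`IsSol.exists_extension`), `t < t_φ` means that there is a solution on `[0, t]`
(`lt_escapeTime_iff`).

The derivative of the solution operator in direction `χ` is given by the solution `e` of the
variational equation `e'(t) = D f(x_t) e_t`, `e_0 = χ`. The difference quotient of the flow solves
this equation up to an error which is controlled by the difference quotients of `f` at the pairs
`(x_t, e_t)`; these pairs form a compact set, so the error is uniformly small and Gronwall applies
(`IsVarSol.hasDirectionalDeriv`). Continuity of the derivative is again a Gronwall comparison, with
the error `(D f(y_t) - D f(x_t)) e_t`: it is small by continuity on compact sets in the
Michal-Bastiani case, and uniformly small for `χ` in a bounded set in the Fréchet case, because then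
all the segments `e_t` stay in a bounded set.
-/

namespace FrechetDDE

/-! ### Seminorms and segments -/

section Segments

variable {E : Type*} [NormedAddCommGroup E]

/-- The space of histories `C((-∞, 0], E)` with values in a normed space `E`, with the topology of
locally uniform convergence. -/
abbrev History (E : Type*) [TopologicalSpace E] : Type _ := C(Iic (0 : ℝ), E)

/-- The segment `s ↦ x (t + s)`, `s ≤ 0`, of a curve `x` defined on all of `ℝ`. -/
def seg (x : C(ℝ, E)) (t : ℝ) : History E :=
  x.comp ⟨fun s : Iic (0 : ℝ) => t + s, by fun_prop⟩

@[simp]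
theorem seg_apply (x : C(ℝ, E)) (t : ℝ) (s : Iic (0 : ℝ)) : seg x t s = x (t + s) := rfl

theorem seg_add (x y : C(ℝ, E)) (t : ℝ) : seg (x + y) t = seg x t + seg y t := rfl

theorem seg_sub (x y : C(ℝ, E)) (t : ℝ) : seg (x - y) t = seg x t - seg y t := rfl

theorem continuous_seg (x : C(ℝ, E)) : Continuous (seg x) :=
  ContinuousMap.continuous_of_continuous_uncurry _ (by
    change Continuous fun p : ℝ × Iic (0 : ℝ) => x (p.1 + p.2)
    fun_prop)

theorem seg_congr {x y : C(ℝ, E)} {t : ℝ} (h : EqOn x y (Iic t)) : seg x t = seg y t := by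
  ext1 s
  exact h (show t + s ≤ t by linarith [show (s : ℝ) ≤ 0 from s.2])

theorem apply_eq_of_seg_eq {x y : C(ℝ, E)} {t : ℝ} (h : seg x t = seg y t) : EqOn x y (Iic t) := by
  intro r hr
  have := DFunLike.congr_fun h ⟨r - t, by simpa using hr⟩
  simpa using this

theorem seg_zero_eq_iff {x : C(ℝ, E)} {φ : History E} :
    seg x 0 = φ ↔ ∀ s : Iic (0 : ℝ), x s = φ s := by
  constructor
  · rintro rfl s
    simp
  · intro h
    ext1 s
    simpa using h s

theorem isCompact_image_seg (x : C(ℝ, E)) (a : ℝ) : IsCompact (seg x '' Icc 0 a) :=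
  isCompact_Icc.image (continuous_seg x)

/-- The curve `s ↦ x (t + s)`. -/
def shift (x : C(ℝ, E)) (t : ℝ) : C(ℝ, E) := x.comp ⟨fun s => t + s, by fun_prop⟩

theorem seg_shift (x : C(ℝ, E)) (t s : ℝ) : seg (shift x t) s = seg x (t + s) := by
  ext1 r
  simp [shift, add_assoc]

/-- The extension of a history to a curve on `ℝ` which is constant on `[0, ∞)`. -/
noncomputable def constExtend (φ : History E) : C(ℝ, E) :=
  φ.comp ⟨fun t : ℝ => (⟨min t 0, mem_Iic.2 (min_le_right _ _)⟩ : Iic (0 : ℝ)),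
    Continuous.subtype_mk (by fun_prop) _⟩

theorem seg_constExtend (φ : History E) : seg (constExtend φ) 0 = φ :=
  seg_zero_eq_iff.2 fun s => by simp [constExtend, min_eq_left (show (s : ℝ) ≤ 0 from s.2)]

variable [NormedSpace ℝ E]

/-- The seminorm `φ ↦ sup_{-T ≤ s ≤ 0} ‖φ s‖` on histories. -/
noncomputable def histSeminorm (T : ℝ) : Seminorm ℝ (History E) :=
  (normSeminorm ℝ C(Icc (-T) (0 : ℝ), E)).comp (σ₁₂ := RingHom.id ℝ)
    { toFun := fun φ => φ.comp ⟨fun s : Icc (-T) (0 : ℝ) => (⟨s, s.2.2⟩ : Iic (0 : ℝ)), by fun_prop⟩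
      map_add' := fun _ _ => rfl
      map_smul' := fun _ _ => rfl }

theorem histSeminorm_le_iff {T M : ℝ} (hM : 0 ≤ M) {φ : History E} :
    histSeminorm T φ ≤ M ↔ ∀ s : Iic (0 : ℝ), -T ≤ s → ‖φ s‖ ≤ M := by
  rw [histSeminorm, Seminorm.comp_apply, coe_normSeminorm, ContinuousMap.norm_le _ hM]
  exact ⟨fun h s hs => h ⟨s, hs, s.2⟩, fun h s => h ⟨s, s.2.2⟩ s.2.1⟩

theorem norm_le_histSeminorm {T : ℝ} (φ : History E) {s : Iic (0 : ℝ)} (hs : -T ≤ s) :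
    ‖φ s‖ ≤ histSeminorm T φ :=
  (histSeminorm_le_iff (apply_nonneg _ _)).1 le_rfl s hs

theorem histSeminorm_mono {T T' : ℝ} (h : T ≤ T') (φ : History E) :
    histSeminorm T φ ≤ histSeminorm T' φ :=
  (histSeminorm_le_iff (apply_nonneg _ _)).2 fun _ hs => norm_le_histSeminorm φ (by linarith)

theorem continuous_histSeminorm (T : ℝ) : Continuous (histSeminorm T : History E → ℝ) :=
  continuous_norm.comp (ContinuousMap.continuous_precomp (Y := Iic (0 : ℝ)) (Z := E)
    ⟨fun s : Icc (-T) (0 : ℝ) => (⟨s, s.2.2⟩ : Iic (0 : ℝ)), by fun_prop⟩)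

theorem mem_nhds_zero_iff_histSeminorm {s : Set (History E)} :
    s ∈ 𝓝 0 ↔ ∃ T δ : ℝ, 0 ≤ T ∧ 0 < δ ∧ ∀ z : History E, histSeminorm T z < δ → z ∈ s := by
  constructor
  · intro h
    obtain ⟨⟨K, V⟩, ⟨hK, hV⟩, hKV⟩ :=
      ((Metric.nhds_basis_ball (x := (0 : E))).uniformity_of_nhds_zero
        |>.compactConvergenceUniformity (α := Iic (0 : ℝ))).mem_iff.1
        (show _ from (UniformSpace.mem_nhds_iff.1 h).choose_spec.1)
    obtain ⟨m, hm⟩ := (hK.image continuous_subtype_val).bddBelow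
    refine ⟨max 0 (-m), V, le_max_left _ _, hV, fun z hz => ?_⟩
    refine (UniformSpace.mem_nhds_iff.1 h).choose_spec.2 (hKV ?_)
    intro s hs
    have h1 : m ≤ s := hm ⟨s, hs, rfl⟩
    have h2 := norm_le_histSeminorm z (s := s) (T := max 0 (-m))
      (by linarith [le_max_right 0 (-m)])
    simpa using h2.trans_lt hz
  · rintro ⟨T, δ, -, hδ, h⟩
    have : {z : History E | histSeminorm T z < δ} ∈ 𝓝 0 :=
      (isOpen_lt (continuous_histSeminorm T) continuous_const).mem_nhds (by simpa using hδ)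
    exact mem_of_superset this h

theorem mem_nhds_iff_histSeminorm {s : Set (History E)} {φ : History E} :
    s ∈ 𝓝 φ ↔ ∃ T δ : ℝ, 0 ≤ T ∧ 0 < δ ∧ ∀ ψ : History E, histSeminorm T (ψ - φ) < δ → ψ ∈ s := by
  rw [← map_add_left_nhds_zero φ, mem_map, mem_nhds_zero_iff_histSeminorm]
  refine exists₂_congr fun T δ => and_congr_right fun _ => and_congr_right fun _ =>
    ⟨fun h ψ hψ => ?_, fun h z hz => h _ (by simpa using hz)⟩
  simpa using h _ hψ

theorem tendsto_iff_histSeminorm {α : Type*} {l : Filter α} {g : α → History E} {φ : History E} :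
    Tendsto g l (𝓝 φ) ↔ ∀ T, 0 ≤ T → ∀ ε, 0 < ε → ∀ᶠ i in l, histSeminorm T (g i - φ) < ε := by
  constructor
  · intro h T hT ε hε
    exact h (mem_nhds_iff_histSeminorm.2 ⟨T, ε, hT, hε, fun _ h => h⟩)
  · intro h s hs
    obtain ⟨T, δ, hT, hδ, H⟩ := mem_nhds_iff_histSeminorm.1 hs
    exact (h T hT δ hδ).mono fun i hi => H _ hi

theorem withSeminorms_histSeminorm :
    WithSeminorms (fun T : ℝ => (histSeminorm T : Seminorm ℝ (History E))) := by
  rw [SeminormFamily.withSeminorms_iff_nhds_eq_iInf]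
  refine le_antisymm (le_iInf fun T => ?_) fun s hs => ?_
  · rw [← tendsto_iff_comap]
    simpa using (continuous_histSeminorm (E := E) T).tendsto 0
  · obtain ⟨T, δ, hT, hδ, H⟩ := mem_nhds_zero_iff_histSeminorm.1 hs
    refine mem_iInf_of_mem T ⟨Iio δ, Iio_mem_nhds hδ, H⟩

theorem seg_smul (r : ℝ) (x : C(ℝ, E)) (t : ℝ) : seg (r • x) t = r • seg x t := rfl

theorem histSeminorm_seg_le {x : C(ℝ, E)} {t T M : ℝ} (hM : 0 ≤ M)
    (h : ∀ r, t - T ≤ r → r ≤ t → ‖x r‖ ≤ M) : histSeminorm T (seg x t) ≤ M :=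
  (histSeminorm_le_iff hM).2 fun s hs => h (t + s) (by linarith)
    (by linarith [show (s : ℝ) ≤ 0 from s.2])

theorem norm_le_histSeminorm_seg (x : C(ℝ, E)) {t T r : ℝ} (h₁ : t - T ≤ r) (h₂ : r ≤ t) :
    ‖x r‖ ≤ histSeminorm T (seg x t) := by
  have := norm_le_histSeminorm (T := T) (seg x t) (s := ⟨r - t, by simpa using h₂⟩)
    (by simp only; linarith)
  simpa using this

/-- The segment at time `t ≥ 0` consists of a piece of the initial segment and of values on
`[0, t]`. -/
theorem histSeminorm_seg_le_add {x : C(ℝ, E)} {t T M : ℝ} (hM : 0 ≤ M)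
    (h : ∀ r ∈ Icc 0 t, ‖x r‖ ≤ M) (ht : 0 ≤ t) :
    histSeminorm T (seg x t) ≤ histSeminorm T (seg x 0) + M := by
  have hp : 0 ≤ histSeminorm T (seg x 0) := apply_nonneg _ _
  refine histSeminorm_seg_le (by positivity) fun r hr hrt => ?_
  rcases le_total r 0 with h0 | h0
  · linarith [norm_le_histSeminorm_seg x (t := 0) (T := T) (r := r) (by linarith) h0]
  · linarith [h r ⟨h0, hrt⟩]

end Segments

/-! ### A Gronwall estimate and global existence for Lipschitz delay equations -/

section Lipschitz

variable {E : Type*} [NormedAddCommGroup E] [NormedSpace ℝ E]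

/-- The constant in the Gronwall estimate `norm_le_gronwallConst`. -/
noncomputable def gronwallConst (a c : ℝ) : ℝ :=
  2 * (1 + c * a + a) * Real.exp ((2 * c + 1) * a)

theorem gronwallConst_nonneg {a c : ℝ} (ha : 0 ≤ a) (hc : 0 ≤ c) : 0 ≤ gronwallConst a c := by
  unfold gronwallConst; positivity

theorem hasDerivWithinAt_Ici_of_Icc {d : ℝ → E} {d' : E} {a t : ℝ}
    (h : HasDerivWithinAt d d' (Icc 0 a) t) (ht : t ∈ Ico 0 a) :
    HasDerivWithinAt d d' (Ici t) t :=
  h.mono_of_mem_nhdsWithin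
    (mem_of_superset (Icc_mem_nhdsGE ht.2) (Icc_subset_Icc_left ht.1))

/-- A Gronwall estimate for delay differential inequalities. -/
theorem norm_le_gronwallConst {d : C(ℝ, E)} {d' : ℝ → E} {a c η T : ℝ} (hc : 0 ≤ c) (hη : 0 ≤ η)
    (hT : 0 ≤ T) (hd : ∀ t ∈ Icc 0 a, HasDerivWithinAt d (d' t) (Icc 0 a) t)
    (hb : ∀ t ∈ Icc 0 a, ‖d' t‖ ≤ c * histSeminorm T (seg d t) + η) :
    ∀ t ∈ Icc 0 a, ‖d t‖ ≤ gronwallConst a c * (histSeminorm T (seg d 0) + η) := by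
  intro t ht
  have ha : 0 ≤ a := ht.1.trans ht.2
  set l : ℝ := 2 * c + 1 with hl
  have hl0 : 0 < l := by positivity
  set A := histSeminorm T (seg d 0) with hA
  have hA0 : 0 ≤ A := apply_nonneg _ _
  -- `m` is the norm of `d` on `[0, a]` with the weight `exp (-l t)`
  obtain ⟨r, hr, hmax⟩ := isCompact_Icc.exists_isMaxOn (nonempty_Icc.2 ha)
    (f := fun t => Real.exp (-(l * t)) * ‖d t‖) (by fun_prop)
  set m := Real.exp (-(l * r)) * ‖d r‖ with hm
  have hm0 : 0 ≤ m := by positivity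
  have hdm : ∀ s ∈ Icc 0 a, ‖d s‖ ≤ m * Real.exp (l * s) := by
    intro s hs
    have h1 : Real.exp (-(l * s)) * ‖d s‖ ≤ m := hmax hs
    calc ‖d s‖ = (Real.exp (-(l * s)) * ‖d s‖) * Real.exp (l * s) := by
          rw [mul_right_comm, ← Real.exp_add]; simp
      _ ≤ _ := by gcongr
  have hseg : ∀ s ∈ Icc 0 a, histSeminorm T (seg d s) ≤ A + m * Real.exp (l * s) := by
    intro s hs
    refine histSeminorm_seg_le_add (by positivity) (fun q hq => ?_) hs.1
    refine (hdm q ⟨hq.1, hq.2.trans hs.2⟩).trans ?_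
    gcongr
    exact hq.2
  have hB : ∀ s ∈ Icc 0 a, ‖d s‖ ≤ A + (c * A + η) * s + c * m / l * Real.exp (l * s) := by
    refine image_norm_le_of_norm_deriv_right_le_deriv_boundary (f' := d')
      (B' := fun s => (c * A + η) + c * m * Real.exp (l * s)) d.continuous.continuousOn
      (fun s hs => hasDerivWithinAt_Ici_of_Icc (hd s ⟨hs.1, hs.2.le⟩) hs) ?_ (fun s => ?_)
      fun s hs => ?_
    · have := norm_le_histSeminorm_seg d (t := 0) (T := T) (r := 0) (by linarith) le_rfl
      have h2 : 0 ≤ c * m / l := by positivity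
      simp only [mul_zero, add_zero, Real.exp_zero, mul_one]
      linarith
    · have h1 : HasDerivAt (fun s => Real.exp (l * s)) (Real.exp (l * s) * l) s := by
        simpa using ((hasDerivAt_id s).const_mul l).exp
      refine ((((hasDerivAt_id s).const_mul (c * A + η)).const_add A).add
        (h1.const_mul (c * m / l))).congr_deriv ?_
      rw [mul_one, mul_comm (Real.exp _) l, ← mul_assoc, div_mul_cancel₀ _ hl0.ne']
    · have hs' : s ∈ Icc 0 a := ⟨hs.1, hs.2.le⟩
      refine (hb s hs').trans ?_
      have := mul_le_mul_of_nonneg_left (hseg s hs') hc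
      linarith
  have hm' : m ≤ 2 * (1 + c * a + a) * (A + η) := by
    have h1 := hB r hr
    have h2 : c / l ≤ 1 / 2 := by
      rw [div_le_div_iff₀ hl0 two_pos]; linarith
    have h3 : Real.exp (-(l * r)) ≤ 1 := Real.exp_le_one_iff.2 (by
      have := mul_nonneg hl0.le hr.1; linarith)
    have h4 : 0 ≤ (c * A + η) * r := by have := hr.1; positivity
    have h5 : (c * A + η) * r ≤ (c * A + η) * a := by gcongr; exact hr.2
    have h6 : m ≤ (A + (c * A + η) * r) + c * m / l := by
      calc m ≤ Real.exp (-(l * r)) *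
            (A + (c * A + η) * r + c * m / l * Real.exp (l * r)) := by rw [hm]; gcongr
        _ = Real.exp (-(l * r)) * (A + (c * A + η) * r) + c * m / l := by
            rw [mul_add, mul_left_comm, ← Real.exp_add]; simp
        _ ≤ 1 * (A + (c * A + η) * r) + c * m / l := by gcongr
        _ = _ := by ring
    have h7 : c * m / l ≤ m / 2 := by
      calc c * m / l = c / l * m := by ring
        _ ≤ 1 / 2 * m := by gcongr
        _ = m / 2 := by ring
    have h8 : 0 ≤ a * A := by positivity
    have h9 : 0 ≤ c * a * η := by positivity
    nlinarith
  calc ‖d t‖ ≤ m * Real.exp (l * t) := hdm t ht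
    _ ≤ (2 * (1 + c * a + a) * (A + η)) * Real.exp (l * a) := by
        gcongr
        exact ht.2
    _ = _ := by unfold gronwallConst; ring

theorem histSeminorm_seg_le_gronwallConst {d : C(ℝ, E)} {d' : ℝ → E} {a c η T : ℝ} (hc : 0 ≤ c)
    (hη : 0 ≤ η) (hT : 0 ≤ T) (hd : ∀ t ∈ Icc 0 a, HasDerivWithinAt d (d' t) (Icc 0 a) t)
    (hb : ∀ t ∈ Icc 0 a, ‖d' t‖ ≤ c * histSeminorm T (seg d t) + η) (S : ℝ) :
    ∀ t ∈ Icc 0 a, histSeminorm S (seg d t) ≤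
      histSeminorm S (seg d 0) + gronwallConst a c * (histSeminorm T (seg d 0) + η) := by
  intro t ht
  have hp : 0 ≤ histSeminorm T (seg d 0) := apply_nonneg _ _
  have hg := gronwallConst_nonneg (ht.1.trans ht.2) hc
  exact histSeminorm_seg_le_add (by positivity)
    (fun r hr => norm_le_gronwallConst hc hη hT hd hb r ⟨hr.1, hr.2.trans ht.2⟩) ht.1

variable [CompleteSpace E]

/-- Global existence for delay equations `x'(t) = G(t, x_t)` with a right-hand side which is
Lipschitz with respect to one of the seminorms. The solution is `φ (min t 0) + y t`, where `y` is
obtained as a fixed point of the integral operator on `C([0, a], E)`, which is a contraction for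
the weighted norm `sup ‖exp (-l t) y t‖` with large `l`. -/
theorem exists_solution_of_lipschitz {G : ℝ → History E → E} {a c T : ℝ} (ha : 0 ≤ a) (hc : 0 ≤ c)
    (hG : ContinuousOn (fun p : ℝ × History E => G p.1 p.2) (Icc 0 a ×ˢ univ))
    (hL : ∀ s ∈ Icc 0 a, ∀ u w, ‖G s u - G s w‖ ≤ c * histSeminorm T (u - w)) (φ : History E) :
    ∃ x : C(ℝ, E), seg x 0 = φ ∧
      ∀ t ∈ Icc 0 a, HasDerivWithinAt x (G t (seg x t)) (Icc 0 a) t := by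
  set l : ℝ := 4 * c + 1 with hl
  have hl0 : 0 < l := by positivity
  let Y : C(Icc 0 a, E) → C(ℝ, E) := fun w => constExtend φ +
    ⟨fun r => Real.exp (l * projIcc 0 a ha r) • w (projIcc 0 a ha r) - w ⟨0, left_mem_Icc.2 ha⟩, by
      fun_prop⟩
  have hY : ∀ w r, Y w r = constExtend φ r + (Real.exp (l * projIcc 0 a ha r) •
      w (projIcc 0 a ha r) - w ⟨0, left_mem_Icc.2 ha⟩) := fun _ _ => rfl
  let g : C(Icc 0 a, E) → ℝ → E := fun w s => G (projIcc 0 a ha s) (seg (Y w) s)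
  have hg : ∀ w, Continuous (g w) := fun w => by
    refine hG.comp_continuous (f := fun s => ((projIcc 0 a ha s : ℝ), seg (Y w) s)) ?_ ?_
    · exact Continuous.prodMk (by fun_prop) (continuous_seg _)
    · exact fun s => ⟨(projIcc 0 a ha s).2, mem_univ _⟩
  let F : C(Icc 0 a, E) → ℝ → E := fun w t => ∫ s in (0 : ℝ)..t, g w s
  have hF : ∀ w t, HasDerivAt (F w) (g w t) t := fun w t =>
    ((hg w).integral_hasStrictDerivAt 0 t).hasDerivAt
  have hFc : ∀ w, Continuous (F w) := fun w =>
    continuous_iff_continuousAt.2 fun t => (hF w t).continuousAt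
  let K : C(Icc 0 a, E) → C(Icc 0 a, E) := fun w =>
    ⟨fun t => Real.exp (-(l * t)) • F w t, by
      have := hFc w
      fun_prop⟩
  have hK : ContractingWith (1 / 2) K := by
    refine ⟨by norm_num, LipschitzWith.of_dist_le_mul fun w w' => ?_⟩
    have hD0 : 0 ≤ dist w w' := dist_nonneg
    have hYY : ∀ s ∈ Icc 0 a, histSeminorm T (seg (Y w) s - seg (Y w') s) ≤
        2 * Real.exp (l * s) * dist w w' := by
      intro s hs
      rw [← seg_sub]
      refine histSeminorm_seg_le (by positivity) fun r _ hr => ?_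
      have hpr : (projIcc 0 a ha r : ℝ) ≤ s := by
        rw [coe_projIcc]
        exact max_le hs.1 ((min_le_right _ _).trans hr)
      have h1 : ‖w (projIcc 0 a ha r) - w' (projIcc 0 a ha r)‖ ≤ dist w w' := by
        rw [← dist_eq_norm]; exact ContinuousMap.dist_apply_le_dist _
      have h2 : ‖w ⟨0, left_mem_Icc.2 ha⟩ - w' ⟨0, left_mem_Icc.2 ha⟩‖ ≤ dist w w' := by
        rw [← dist_eq_norm]; exact ContinuousMap.dist_apply_le_dist _
      have h3 : (1 : ℝ) ≤ Real.exp (l * s) := Real.one_le_exp (mul_nonneg hl0.le hs.1)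
      have h4 : (Y w - Y w') r = Real.exp (l * projIcc 0 a ha r) •
          (w (projIcc 0 a ha r) - w' (projIcc 0 a ha r)) -
            (w ⟨0, left_mem_Icc.2 ha⟩ - w' ⟨0, left_mem_Icc.2 ha⟩) := by
        rw [ContinuousMap.sub_apply, hY, hY, smul_sub]; abel
      rw [h4]
      refine (norm_sub_le _ _).trans ?_
      rw [norm_smul, Real.norm_of_nonneg (Real.exp_pos _).le]
      calc _ ≤ Real.exp (l * s) * dist w w' + 1 * dist w w' := by
            rw [one_mul]
            gcongr
        _ ≤ Real.exp (l * s) * dist w w' + Real.exp (l * s) * dist w w' := by gcongr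
        _ = _ := by ring
    have hFF : ∀ t ∈ Icc 0 a, ‖F w t - F w' t‖ ≤ 2 * c * dist w w' / l * Real.exp (l * t) := by
      refine image_norm_le_of_norm_deriv_right_le_deriv_boundary
        (f := fun t => F w t - F w' t) (f' := fun t => g w t - g w' t)
        (B' := fun t => 2 * c * dist w w' * Real.exp (l * t))
        ((hFc w).sub (hFc w')).continuousOn
        (fun t _ => ((hF w t).sub (hF w' t)).hasDerivWithinAt) ?_ (fun s => ?_) fun s hs => ?_
      · simp only [F, intervalIntegral.integral_same, sub_zero, norm_zero]
        positivity
      · have h1 : HasDerivAt (fun s => Real.exp (l * s)) (Real.exp (l * s) * l) s := by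
          simpa using ((hasDerivAt_id s).const_mul l).exp
        refine (h1.const_mul (2 * c * dist w w' / l)).congr_deriv ?_
        rw [mul_comm (Real.exp _) l, ← mul_assoc, div_mul_cancel₀ _ hl0.ne']
      · have hs' : s ∈ Icc 0 a := ⟨hs.1, hs.2.le⟩
        refine (hL _ (projIcc 0 a ha s).2 _ _).trans ?_
        have := mul_le_mul_of_nonneg_left (hYY s hs') hc
        linarith
    rw [ContinuousMap.dist_le (by positivity)]
    intro t
    rw [dist_eq_norm]
    change ‖Real.exp (-(l * t)) • F w t - Real.exp (-(l * t)) • F w' t‖ ≤ _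
    rw [← smul_sub, norm_smul, Real.norm_of_nonneg (Real.exp_pos _).le]
    calc _ ≤ Real.exp (-(l * t)) * (2 * c * dist w w' / l * Real.exp (l * t)) := by
          gcongr; exact hFF t t.2
      _ = 2 * c / l * dist w w' := by
          rw [mul_left_comm, ← Real.exp_add]; simp; ring
      _ ≤ 1 / 2 * dist w w' := by
          have : 2 * c / l ≤ 1 / 2 := by
            rw [div_le_div_iff₀ hl0 two_pos]; linarith
          gcongr
      _ = _ := by norm_num
  obtain ⟨w, hw⟩ : ∃ w, K w = w := ⟨_, hK.fixedPoint_isFixedPt⟩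
  have hwt : ∀ t : Icc 0 a, Real.exp (l * t) • w t = F w t := by
    intro t
    have h1 : Real.exp (-(l * t)) • F w t = w t := DFunLike.congr_fun hw t
    rw [← h1, smul_smul, ← Real.exp_add]
    simp
  have hw0 : w ⟨0, left_mem_Icc.2 ha⟩ = 0 := by
    have := hwt ⟨0, left_mem_Icc.2 ha⟩
    simpa [F] using this
  refine ⟨Y w, ?_, fun t ht => ?_⟩
  · rw [seg_zero_eq_iff]
    intro s
    have hs : (s : ℝ) ≤ 0 := s.2
    have h1 := seg_zero_eq_iff.1 (seg_constExtend φ) s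
    rw [hY, projIcc_of_le_left ha hs, hw0, h1]
    simp
  · have h1 : ∀ r ∈ Icc 0 a, Y w r = φ ⟨0, self_mem_Iic⟩ + F w r := by
      intro r hr
      rw [hY, projIcc_of_mem ha hr, hw0, sub_zero, hwt ⟨r, hr⟩]
      simp [constExtend, min_eq_right hr.1]
    have h2 : g w t = G t (seg (Y w) t) := by
      simp only [g, projIcc_of_mem ha ht]
    rw [← h2]
    exact ((hF w t).const_add _).hasDerivWithinAt.congr h1 (h1 t ht)

end Lipschitz

/-! ### Directional derivatives and uniform estimates near compact sets -/

section DirectionalDeriv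

variable {V W : Type*} [AddCommGroup V] [Module ℝ V] [AddCommGroup W] [Module ℝ W]
  [TopologicalSpace W]

theorem HasDirectionalDeriv.const_smul [ContinuousConstSMul ℝ W] {f : V → W} {u v : V} {w : W}
    (h : HasDirectionalDeriv f u v w) (r : ℝ) : HasDirectionalDeriv f u (r • v) (r • w) := by
  rcases eq_or_ne r 0 with rfl | hr
  · simpa [HasDirectionalDeriv] using tendsto_const_nhds
  · have h1 : Tendsto (fun s : ℝ => s * r) (𝓝[≠] 0) (𝓝[≠] 0) := by
      refine tendsto_nhdsWithin_iff.2 ⟨tendsto_nhdsWithin_of_tendsto_nhds ?_, ?_⟩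
      · exact Continuous.tendsto' (by fun_prop) _ _ (by simp)
      · exact eventually_nhdsWithin_of_forall fun s hs => mul_ne_zero hs hr
    refine ((h.comp h1).const_smul r).congr fun s => ?_
    rw [Function.comp_apply, smul_smul, smul_smul, mul_inv_rev, mul_inv_cancel_left₀ hr]

theorem HasDirectionalDeriv.unique [T2Space W] {f : V → W} {u v : V} {w w' : W}
    (h : HasDirectionalDeriv f u v w) (h' : HasDirectionalDeriv f u v w') : w = w' :=
  tendsto_nhds_unique h h'

theorem HasDirectionalDeriv.hasDerivAt {F : Type*} [NormedAddCommGroup F] [NormedSpace ℝ F]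
    {f : V → F} {u v : V} {θ : ℝ} {w : F} (h : HasDirectionalDeriv f (u + θ • v) v w) :
    HasDerivAt (fun s : ℝ => f (u + s • v)) w θ := by
  rw [hasDerivAt_iff_tendsto_slope_zero]
  refine Tendsto.congr (fun s => ?_) h
  rw [add_smul, add_assoc]

/-- On a first countable space, Fréchet smooth maps are smooth in the sense of Michal and
Bastiani: for convergent sequences `v_k` the derivatives converge uniformly on the bounded set
`{v_k}`. -/
theorem continuousOn_uncurry_of_continuousOn [TopologicalSpace V]
    [IsTopologicalAddGroup V] [ContinuousSMul ℝ V] [FirstCountableTopology V] {F : Type*}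
    [NormedAddCommGroup F] [NormedSpace ℝ F]
    {D : V → V →L[ℝ] F} {U : Set V} (hD : ContinuousOn D U) :
    ContinuousOn (fun p : V × V => D p.1 p.2) (U ×ˢ univ) := by
  rintro ⟨u, v⟩ ⟨hu, -⟩
  refine tendsto_of_seq_tendsto fun p hp => ?_
  rw [nhdsWithin_prod_eq, nhdsWithin_univ, tendsto_prod_iff'] at hp
  obtain ⟨h1, h2⟩ := hp
  let _ : UniformSpace V := IsTopologicalAddGroup.rightUniformSpace V
  have _ : IsUniformAddGroup V := isUniformAddGroup_of_addCommGroup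
  have hB := h2.isVonNBounded_range ℝ
  have h3 : Tendsto (fun k => D (p k).1 - D u) atTop (𝓝 0) := by
    simpa using ((hD u hu).tendsto.comp h1).sub_const (D u)
  have h4 : Tendsto (fun k => (D (p k).1 - D u) (p k).2) atTop (𝓝 0) := by
    rw [Metric.tendsto_nhds]
    intro ε hε
    have := h3 (ContinuousLinearMap.hasBasis_nhds_zero.mem_of_mem
      (i := (_, Metric.ball 0 ε)) ⟨hB, Metric.ball_mem_nhds _ hε⟩)
    filter_upwards [this] with k hk
    exact hk _ ⟨k, rfl⟩
  have h5 : Tendsto (fun k => D u (p k).2) atTop (𝓝 (D u v)) := ((D u).continuous.tendsto v).comp h2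
  refine (h4.add h5).congr' (.of_forall fun k => ?_) |>.trans (by simp)
  simp

end DirectionalDeriv

section Compact

variable {E F : Type*} [NormedAddCommGroup E] [NormedSpace ℝ E] [NormedAddCommGroup F]
  {U : Set (History E)} {f : History E → F} {D : History E → History E → F}

/-- Continuity of the derivative, uniform with respect to a compact set of base points and
directions. -/
theorem eventually_forall_dist_deriv_le (hU : IsOpen U)
    (hD : ContinuousOn (fun p : History E × History E => D p.1 p.2) (U ×ˢ univ))
    {K : Set (History E × History E)} (hK : IsCompact K) (hKU : ∀ p ∈ K, p.1 ∈ U) {η : ℝ}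
    (hη : 0 < η) :
    ∃ T δ : ℝ, 0 ≤ T ∧ 0 < δ ∧ ∀ z : History E, histSeminorm T z < δ → ∀ p ∈ K,
      p.1 + z ∈ U ∧ ‖D (p.1 + z) p.2 - D p.1 p.2‖ ≤ η := by
  refine mem_nhds_zero_iff_histSeminorm.1
    (hK.eventually_forall_of_forall_eventually (P := fun z p => p.1 + z ∈ U ∧
      ‖D (p.1 + z) p.2 - D p.1 p.2‖ ≤ η) ?_)
  rintro ⟨u, v⟩ hp
  have hu : u ∈ U := hKU _ hp
  have hDat : ContinuousAt (fun p : History E × History E => D p.1 p.2) (u, v) :=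
    hD.continuousAt ((hU.prod isOpen_univ).mem_nhds ⟨hu, mem_univ _⟩)
  have h1 : Tendsto (fun q : History E × (History E × History E) => q.2.1 + q.1) (𝓝 (0, (u, v)))
      (𝓝 u) := Continuous.tendsto' (by fun_prop) _ _ (by simp)
  have h2 : Tendsto (fun q : History E × (History E × History E) =>
      D (q.2.1 + q.1) q.2.2 - D q.2.1 q.2.2) (𝓝 (0, (u, v))) (𝓝 0) := by
    rw [← sub_self (D u v)]
    refine Tendsto.sub ?_ ?_
    · have : Tendsto (fun q : History E × (History E × History E) => (q.2.1 + q.1, q.2.2))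
          (𝓝 (0, (u, v))) (𝓝 (u, v)) := Continuous.tendsto' (by fun_prop) _ _ (by simp)
      exact hDat.tendsto.comp this
    · exact hDat.tendsto.comp (continuous_snd.tendsto (0, (u, v)))
  filter_upwards [h1 (hU.mem_nhds hu), h2 (Metric.closedBall_mem_nhds 0 hη)] with q h3 h4
  exact ⟨h3, by simpa using h4⟩

/-- `f` and its derivative `D` satisfy a Lipschitz estimate on the tube of radius `δ`, measured by
the seminorm on `[-T, 0]`, around the set `K`, and the tube is contained in `U`. -/
structure IsLipschitzTube (U : Set (History E)) (f : History E → F) (D : History E → History E → F)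
    (K : Set (History E)) (T δ c : ℝ) : Prop where
  T_nonneg : 0 ≤ T
  δ_pos : 0 < δ
  c_nonneg : 0 ≤ c
  mem : ∀ u ∈ K, ∀ z, histSeminorm T z < δ → u + z ∈ U
  lipschitz : ∀ u ∈ K, ∀ z w, histSeminorm T z < δ → histSeminorm T w < δ →
    ‖f (u + z) - f (u + w)‖ ≤ c * histSeminorm T (z - w)
  deriv_lipschitz : ∀ u ∈ K, ∀ z, histSeminorm T z < δ → ∀ v w,
    ‖D (u + z) v - D (u + z) w‖ ≤ c * histSeminorm T (v - w)

theorem IsLipschitzTube.mono {K K' : Set (History E)} {T δ c : ℝ}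
    (h : IsLipschitzTube U f D K T δ c) (hK : K' ⊆ K) : IsLipschitzTube U f D K' T δ c :=
  ⟨h.T_nonneg, h.δ_pos, h.c_nonneg, fun u hu => h.mem u (hK hu), fun u hu => h.lipschitz u (hK hu),
    fun u hu => h.deriv_lipschitz u (hK hu)⟩

variable [NormedSpace ℝ F]

/-- For Fréchet smooth maps the continuity is uniform with respect to directions in a
bounded set. -/
theorem eventually_forall_dist_deriv_le_of_bounded (hU : IsOpen U)
    {D : History E → History E →L[ℝ] F} (hD : ContinuousOn D U) {K B : Set (History E)}
    (hK : IsCompact K) (hKU : K ⊆ U) (hB : Bornology.IsVonNBounded ℝ B) {η : ℝ} (hη : 0 < η) :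
    ∃ T δ : ℝ, 0 ≤ T ∧ 0 < δ ∧ ∀ z : History E, histSeminorm T z < δ → ∀ u ∈ K,
      u + z ∈ U ∧ ∀ v ∈ B, ‖D (u + z) v - D u v‖ ≤ η := by
  refine mem_nhds_zero_iff_histSeminorm.1
    (hK.eventually_forall_of_forall_eventually (P := fun z u => u + z ∈ U ∧
      ∀ v ∈ B, ‖D (u + z) v - D u v‖ ≤ η) ?_)
  intro u hu
  have hDat : ContinuousAt D u := hD.continuousAt (hU.mem_nhds (hKU hu))
  have h1 : Tendsto (fun q : History E × History E => q.2 + q.1) (𝓝 (0, u)) (𝓝 u) :=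
    Continuous.tendsto' (by fun_prop) _ _ (by simp)
  have h2 : Tendsto (fun q : History E × History E => D (q.2 + q.1) - D q.2) (𝓝 (0, u)) (𝓝 0) := by
    rw [← sub_self (D u)]
    exact (hDat.tendsto.comp h1).sub (hDat.tendsto.comp (continuous_snd.tendsto (0, u)))
  have h3 := h2 (ContinuousLinearMap.hasBasis_nhds_zero.mem_of_mem
      (i := (_, Metric.closedBall 0 η)) ⟨hB, Metric.closedBall_mem_nhds _ hη⟩)
  filter_upwards [h1 (hU.mem_nhds (hKU hu)), h3] with q h4 h5
  exact ⟨h4, fun v hv => by simpa using h5 v hv⟩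

/-- The difference quotients of `f` converge to the directional derivatives uniformly on compact
sets of base points and directions. -/
theorem exists_norm_slope_sub_le (hU : IsOpen U)
    (hf : ∀ u ∈ U, ∀ v, HasDirectionalDeriv f u v (D u v))
    (hD : ContinuousOn (fun p : History E × History E => D p.1 p.2) (U ×ˢ univ))
    {K : Set (History E × History E)} (hK : IsCompact K) (hKU : ∀ p ∈ K, p.1 ∈ U) {η : ℝ}
    (hη : 0 < η) :
    ∃ T δ : ℝ, 0 ≤ T ∧ 0 < δ ∧ ∀ p ∈ K, ∀ h : ℝ, h ≠ 0 → |h| * histSeminorm T p.2 < δ →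
      ‖h⁻¹ • (f (p.1 + h • p.2) - f p.1) - D p.1 p.2‖ ≤ η := by
  obtain ⟨T, δ, hT, hδ, H⟩ := eventually_forall_dist_deriv_le hU hD hK hKU hη
  refine ⟨T, δ, hT, hδ, ?_⟩
  rintro ⟨u, v⟩ hp h hh hhδ
  simp only at hhδ ⊢
  have hz : ∀ θ ∈ Icc (0 : ℝ) 1, u + (θ * h) • v ∈ U ∧ ‖D (u + (θ * h) • v) v - D u v‖ ≤ η := by
    intro θ hθ
    refine H _ ?_ _ hp
    rw [map_smul_eq_mul, norm_mul, Real.norm_of_nonneg hθ.1, Real.norm_eq_abs, mul_assoc]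
    have : 0 ≤ histSeminorm T v := apply_nonneg _ _
    exact (mul_le_of_le_one_left (by positivity) hθ.2).trans_lt hhδ
  have key := norm_image_sub_le_of_norm_deriv_le_segment_01'
    (f := fun θ : ℝ => h⁻¹ • f (u + (θ * h) • v) - θ • D u v)
    (f' := fun θ => D (u + (θ * h) • v) v - D u v) (C := η) (fun θ hθ => ?_)
    (fun θ hθ => (hz θ ⟨hθ.1, hθ.2.le⟩).2)
  · convert key using 2
    simp [smul_sub]
    abel
  · have h1 : HasDerivAt (fun s : ℝ => f (u + s • v)) (D (u + (θ * h) • v) v) (θ * h) :=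
      (hf _ (hz θ hθ).1 v).hasDerivAt
    have h2 := (h1.scomp θ ((hasDerivAt_id θ).mul_const h)).const_smul h⁻¹
    have h3 := (hasDerivAt_id θ).smul_const (D u v)
    refine ((h2.sub h3).congr_deriv ?_).hasDerivWithinAt
    simp [smul_smul, inv_mul_cancel₀ hh]

/-- Continuity of `(u, v) ↦ D u v` at the points `(u, 0)` with `u` in a compact set makes the
derivatives bounded with respect to a single seminorm on a tube around the compact set. -/
theorem exists_norm_deriv_le (hU : IsOpen U)
    (hf : ∀ u ∈ U, ∀ v, HasDirectionalDeriv f u v (D u v))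
    (hD : ContinuousOn (fun p : History E × History E => D p.1 p.2) (U ×ˢ univ))
    {K : Set (History E)} (hK : IsCompact K) (hKU : K ⊆ U) :
    ∃ T δ c : ℝ, 0 ≤ T ∧ 0 < δ ∧ 0 ≤ c ∧ ∀ u ∈ K, ∀ z, histSeminorm T z < δ →
      u + z ∈ U ∧ ∀ v, ‖D (u + z) v‖ ≤ c * histSeminorm T v := by
  have hsmul : ∀ u ∈ U, ∀ (r : ℝ) v, D u (r • v) = r • D u v := fun u hu r v =>
    (hf u hu (r • v)).unique ((hf u hu v).const_smul r)
  have hev : ∀ᶠ q : History E × History E in 𝓝 (0, 0),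
      ∀ u ∈ K, u + q.1 ∈ U ∧ ‖D (u + q.1) q.2‖ ≤ 1 := by
    refine hK.eventually_forall_of_forall_eventually (P := fun (q : History E × History E) u =>
      u + q.1 ∈ U ∧ ‖D (u + q.1) q.2‖ ≤ 1) fun u hu => ?_
    have hDat : ContinuousAt (fun p : History E × History E => D p.1 p.2) (u, 0) :=
      hD.continuousAt ((hU.prod isOpen_univ).mem_nhds ⟨hKU hu, mem_univ _⟩)
    have h0 : D u 0 = 0 := by simpa using hsmul u (hKU hu) 0 0
    have h1 : Tendsto (fun q : (History E × History E) × History E => q.2 + q.1.1)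
        (𝓝 ((0, 0), u)) (𝓝 u) := Continuous.tendsto' (by fun_prop) _ _ (by simp)
    have h2 : Tendsto (fun q : (History E × History E) × History E => (q.2 + q.1.1, q.1.2))
        (𝓝 ((0, 0), u)) (𝓝 (u, 0)) := Continuous.tendsto' (by fun_prop) _ _ (by simp)
    have h3 : Tendsto (fun q : (History E × History E) × History E => D (q.2 + q.1.1) q.1.2)
        (𝓝 ((0, 0), u)) (𝓝 0) := by
      rw [← h0]
      exact hDat.tendsto.comp h2
    filter_upwards [h1 (hU.mem_nhds (hKU hu)), h3 (Metric.closedBall_mem_nhds 0 one_pos)]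
      with q h4 h5
    exact ⟨h4, by simpa using h5⟩
  rw [nhds_prod_eq, eventually_prod_iff] at hev
  obtain ⟨p₁, hp₁, p₂, hp₂, H⟩ := hev
  obtain ⟨T₁, δ₁, hT₁, hδ₁, H₁⟩ := mem_nhds_zero_iff_histSeminorm.1 hp₁
  obtain ⟨T₂, δ₂, hT₂, hδ₂, H₂⟩ := mem_nhds_zero_iff_histSeminorm.1 hp₂
  refine ⟨max T₁ T₂, δ₁, 2 / δ₂, hT₁.trans (le_max_left _ _), hδ₁, by positivity,
    fun u hu z hz => ?_⟩
  have hz' : p₁ z := H₁ z ((histSeminorm_mono (le_max_left _ _) z).trans_lt hz)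
  have hzU : u + z ∈ U := by
    have h0 : p₂ 0 := H₂ 0 (by simpa using hδ₂)
    exact (H hz' h0 u hu).1
  refine ⟨hzU, fun v => ?_⟩
  have hv0 : 0 ≤ histSeminorm (max T₁ T₂) v := apply_nonneg _ _
  -- the direction `v` is scaled down to a direction of seminorm less than `δ₂`
  have hr : ∀ r, 2 / δ₂ * histSeminorm (max T₁ T₂) v < r → ‖D (u + z) v‖ ≤ r := by
    intro r hr
    have hr0 : 0 < r := lt_of_le_of_lt (by positivity) hr
    have h1 : histSeminorm T₂ (r⁻¹ • v) < δ₂ := by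
      rw [map_smul_eq_mul, Real.norm_of_nonneg (by positivity), inv_mul_lt_iff₀ hr0]
      rw [div_mul_eq_mul_div, div_lt_iff₀ hδ₂] at hr
      have := histSeminorm_mono (le_max_right T₁ T₂) v
      linarith
    have h2 := (H hz' (H₂ _ h1) u hu).2
    rw [hsmul _ hzU, norm_smul, Real.norm_of_nonneg (by positivity), inv_mul_le_iff₀ hr0] at h2
    simpa using h2
  exact le_of_forall_gt_imp_ge_of_dense hr

theorem exists_isLipschitzTube (hU : IsOpen U)
    (hf : ∀ u ∈ U, ∀ v, HasDirectionalDeriv f u v (D u v))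
    (hD : ContinuousOn (fun p : History E × History E => D p.1 p.2) (U ×ˢ univ))
    {K : Set (History E)} (hK : IsCompact K) (hKU : K ⊆ U) :
    ∃ T δ c : ℝ, IsLipschitzTube U f D K T δ c := by
  obtain ⟨T, δ, c, hT, hδ, hc, H⟩ := exists_norm_deriv_le hU hf hD hK hKU
  have hlip : ∀ u ∈ K, ∀ z w, histSeminorm T z < δ → histSeminorm T w < δ →
      ‖f (u + z) - f (u + w)‖ ≤ c * histSeminorm T (z - w) := by
    intro u hu z w hz hw
    have hθ : ∀ θ ∈ Icc (0 : ℝ) 1, histSeminorm T (w + θ • (z - w)) < δ := by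
      intro θ hθ
      have := (histSeminorm (E := E) T).convex_ball 0 δ ((Seminorm.mem_ball_zero _).2 hw)
        ((Seminorm.mem_ball_zero _).2 hz) (sub_nonneg.2 hθ.2) hθ.1 (by ring)
      rw [Seminorm.mem_ball_zero] at this
      convert this using 2
      module
    have key := norm_image_sub_le_of_norm_deriv_le_segment_01'
      (f := fun θ : ℝ => f ((u + w) + θ • (z - w)))
      (f' := fun θ => D ((u + w) + θ • (z - w)) (z - w)) (C := c * histSeminorm T (z - w))
      (fun θ h => ?_) (fun θ h => ?_)
    · simpa using key
    · refine (HasDirectionalDeriv.hasDerivAt (hf _ ?_ _)).hasDerivWithinAt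
      rw [add_assoc]
      exact (H u hu _ (hθ θ h)).1
    · rw [add_assoc]
      exact (H u hu _ (hθ θ ⟨h.1, h.2.le⟩)).2 _
  refine ⟨T, δ, c, hT, hδ, hc, fun u hu z hz => (H u hu z hz).1, hlip, fun u hu z hz v w => ?_⟩
  have hzU := (H u hu z hz).1
  -- the Lipschitz estimate for `f` passes to the limit of the difference quotients
  refine le_of_tendsto ((hf _ hzU v).sub (hf _ hzU w)).norm ?_
  have hsmall : ∀ v : History E, ∀ᶠ h : ℝ in 𝓝 0, histSeminorm T (z + h • v) < δ := by
    intro v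
    have h1 : Tendsto (fun h : ℝ => histSeminorm T (z + h • v)) (𝓝 0) (𝓝 (histSeminorm T z)) :=
      Continuous.tendsto' ((continuous_histSeminorm T).comp (by fun_prop)) _ _ (by simp)
    exact h1 (Iio_mem_nhds hz)
  filter_upwards [self_mem_nhdsWithin, nhdsWithin_le_nhds (hsmall v), nhdsWithin_le_nhds (hsmall w)]
    with h hh h1 h2
  have hh0 : 0 < |h| := abs_pos.2 hh
  have h3 := hlip u hu _ _ h1 h2
  rw [add_sub_add_left_eq_sub, ← smul_sub, map_smul_eq_mul, Real.norm_eq_abs] at h3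
  rw [← smul_sub, norm_smul, norm_inv, Real.norm_eq_abs, inv_mul_le_iff₀ hh0,
    sub_sub_sub_cancel_right, add_assoc, add_assoc]
  linarith

end Compact

/-! ### Truncation of histories -/

section Truncation

variable {E : Type*} [NormedAddCommGroup E] [NormedSpace ℝ E]

/-- The radial retraction of a normed space onto the closed ball of radius `r > 0`. -/
noncomputable def radialTrunc (r : ℝ) (v : E) : E := (r / max r ‖v‖) • v

theorem norm_radialTrunc_le {r : ℝ} (hr : 0 < r) (v : E) : ‖radialTrunc r v‖ ≤ r := by
  have hm : 0 < max r ‖v‖ := lt_max_of_lt_left hr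
  rw [radialTrunc, norm_smul, Real.norm_of_nonneg (by positivity), div_mul_eq_mul_div,
    div_le_iff₀ hm]
  gcongr
  exact le_max_right _ _

theorem radialTrunc_of_norm_le {r : ℝ} (hr : 0 < r) {v : E} (hv : ‖v‖ ≤ r) :
    radialTrunc r v = v := by
  rw [radialTrunc, max_eq_left hv, div_self hr.ne', one_smul]

theorem norm_radialTrunc_sub_le {r : ℝ} (hr : 0 < r) (v w : E) :
    ‖radialTrunc r v - radialTrunc r w‖ ≤ 2 * ‖v - w‖ := by
  set p := max r ‖v‖ with hp
  set q := max r ‖w‖ with hq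
  have hp0 : 0 < p := lt_max_of_lt_left hr
  have hq0 : 0 < q := lt_max_of_lt_left hr
  have hrp : r ≤ p := le_max_left _ _
  have hpq : |q - p| ≤ ‖v - w‖ := by
    refine (abs_max_sub_max_le_max r ‖w‖ r ‖v‖).trans ?_
    rw [sub_self, abs_zero, max_eq_right (abs_nonneg _), norm_sub_rev]
    exact abs_norm_sub_norm_le w v
  have h1 : radialTrunc r v - radialTrunc r w =
      (r / p) • (v - w) + ((r / p) * ((q - p) / q)) • w := by
    have : r / p - r / q = r / p * ((q - p) / q) := by field_simp
    rw [← this]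
    simp only [radialTrunc, ← hp, ← hq]
    module
  have h2 : r / p ≤ 1 := (div_le_one hp0).2 hrp
  have h3 : ‖w‖ ≤ q := le_max_right _ _
  rw [h1]
  refine (norm_add_le _ _).trans ?_
  rw [norm_smul, norm_smul, Real.norm_of_nonneg (by positivity), Real.norm_eq_abs, abs_mul,
    abs_div (q - p), abs_of_pos hq0, abs_of_nonneg (by positivity : 0 ≤ r / p)]
  calc _ ≤ 1 * ‖v - w‖ + 1 * (‖v - w‖ / q) * q := by gcongr
    _ = _ := by field_simp; ring

theorem continuous_radialTrunc {r : ℝ} (hr : 0 < r) : Continuous (radialTrunc r : E → E) := by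
  refine Continuous.smul ?_ continuous_id
  exact continuous_const.div (by fun_prop) fun v => (lt_max_of_lt_left hr).ne'

/-- Pointwise radial truncation of a history at the radius `r`. -/
noncomputable def truncHistory {r : ℝ} (hr : 0 < r) (φ : History E) : History E :=
  ContinuousMap.comp ⟨radialTrunc r, continuous_radialTrunc hr⟩ φ

theorem continuous_truncHistory {r : ℝ} (hr : 0 < r) :
    Continuous (truncHistory hr : History E → History E) :=
  ContinuousMap.continuous_postcomp _

theorem histSeminorm_truncHistory_le {r : ℝ} (hr : 0 < r) (T : ℝ) (φ : History E) :
    histSeminorm T (truncHistory hr φ) ≤ r :=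
  (histSeminorm_le_iff hr.le).2 fun s _ => norm_radialTrunc_le hr (φ s)

theorem histSeminorm_truncHistory_sub_le {r : ℝ} (hr : 0 < r) (T : ℝ) (φ ψ : History E) :
    histSeminorm T (truncHistory hr φ - truncHistory hr ψ) ≤ 2 * histSeminorm T (φ - ψ) := by
  have h0 : 0 ≤ histSeminorm T (φ - ψ) := apply_nonneg _ _
  refine (histSeminorm_le_iff (by positivity)).2 fun s hs =>
    (norm_radialTrunc_sub_le hr (φ s) (ψ s)).trans ?_
  have := norm_le_histSeminorm (φ - ψ) hs
  rw [ContinuousMap.sub_apply] at this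
  linarith

theorem histSeminorm_truncHistory_sub_self {r : ℝ} (hr : 0 < r) {T : ℝ} {φ : History E}
    (h : histSeminorm T φ ≤ r) : histSeminorm T (truncHistory hr φ - φ) = 0 := by
  refine le_antisymm ((histSeminorm_le_iff le_rfl).2 fun s hs => ?_) (apply_nonneg _ _)
  have : truncHistory hr φ s = φ s :=
    radialTrunc_of_norm_le hr ((norm_le_histSeminorm φ hs).trans h)
  simp [this]

theorem truncHistory_zero {r : ℝ} (hr : 0 < r) : truncHistory hr (0 : History E) = 0 := by
  ext1 s
  exact radialTrunc_of_norm_le hr (by simpa using hr.le)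

end Truncation

/-! ### Solutions as curves on the real line -/

section Solutions

variable {E : Type*} [NormedAddCommGroup E] [NormedSpace ℝ E]

/-- `D` consists of the directional derivatives of `f` on the open set `U`, and `f`, `D` are
continuous on `U` and on `U × V`, respectively. -/
structure IsC1With (U : Set (History E)) (f : History E → E)
    (D : History E → History E → E) : Prop where
  isOpen : IsOpen U
  continuousOn : ContinuousOn f U
  hasDirectionalDeriv : ∀ u ∈ U, ∀ v, HasDirectionalDeriv f u v (D u v)
  continuousOn_deriv : ContinuousOn (fun p : History E × History E => D p.1 p.2) (U ×ˢ univ)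

theorem IsC1With.exists_isLipschitzTube {U : Set (History E)} {f : History E → E}
    {D : History E → History E → E} (h : IsC1With U f D) {K : Set (History E)} (hK : IsCompact K)
    (hKU : K ⊆ U) : ∃ T δ c : ℝ, IsLipschitzTube U f D K T δ c :=
  FrechetDDE.exists_isLipschitzTube h.isOpen h.hasDirectionalDeriv h.continuousOn_deriv hK hKU

/-- `x : ℝ → E` is a continuous curve with `x_0 = φ` which solves `x'(t) = f(x_t)` on `[0, a]`. The
values of `x` on `(a, ∞)` are irrelevant. -/
structure IsSol (U : Set (History E)) (f : History E → E) (a : ℝ) (φ : History E)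
    (x : C(ℝ, E)) : Prop where
  seg_zero : seg x 0 = φ
  seg_mem : ∀ t ∈ Icc 0 a, seg x t ∈ U
  hasDerivWithinAt : ∀ t ∈ Icc 0 a, HasDerivWithinAt x (f (seg x t)) (Icc 0 a) t

variable {U : Set (History E)} {f : History E → E} {D : History E → History E → E} {a b : ℝ}
  {φ : History E} {x y : C(ℝ, E)}

theorem IsSol.mono (h : IsSol U f a φ x) (hba : b ≤ a) : IsSol U f b φ x :=
  ⟨h.seg_zero, fun t ht => h.seg_mem t ⟨ht.1, ht.2.trans hba⟩, fun t ht =>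
    (h.hasDerivWithinAt t ⟨ht.1, ht.2.trans hba⟩).mono (Icc_subset_Icc_right hba)⟩

theorem IsSol.congr (h : IsSol U f a φ x) (ha : 0 ≤ a) (hxy : EqOn x y (Iic a)) :
    IsSol U f a φ y := by
  have hs : ∀ t ∈ Icc 0 a, seg x t = seg y t := fun t ht =>
    seg_congr (hxy.mono (Iic_subset_Iic.2 ht.2))
  refine ⟨(hs 0 ⟨le_rfl, ha⟩).symm.trans h.seg_zero, fun t ht => hs t ht ▸ h.seg_mem t ht,
    fun t ht => hs t ht ▸ (h.hasDerivWithinAt t ht).congr (fun s hs => (hxy hs.2).symm)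
      (hxy ht.2).symm⟩

theorem IsSol.mem (h : IsSol U f a φ x) (ha : 0 ≤ a) : φ ∈ U :=
  h.seg_zero ▸ h.seg_mem 0 ⟨le_rfl, ha⟩

theorem IsSol.image_seg_subset (h : IsSol U f a φ x) : seg x '' Icc 0 a ⊆ U := by
  rintro _ ⟨t, ht, rfl⟩
  exact h.seg_mem t ht

theorem hasDerivWithinAt_shift {t s : ℝ} {v : E} {I : Set ℝ}
    (h : HasDerivWithinAt x v I (t + s)) : HasDerivWithinAt (shift x t) v ((t + ·) ⁻¹' I) s := by
  have h1 : HasDerivWithinAt (fun r => t + r) 1 ((t + ·) ⁻¹' I) s :=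
    ((hasDerivAt_id s).const_add t).hasDerivWithinAt
  have h2 := h.scomp s h1 (mapsTo_preimage _ _)
  rwa [one_smul] at h2

theorem IsSol.shift (h : IsSol U f a φ x) {t : ℝ} (ht : 0 ≤ t) :
    IsSol U f (a - t) (seg x t) (shift x t) := by
  refine ⟨by rw [seg_shift, add_zero], fun s hs => ?_, fun s hs => ?_⟩
  · rw [seg_shift]
    exact h.seg_mem _ ⟨by linarith [hs.1], by linarith [hs.2]⟩
  · rw [seg_shift]
    refine (hasDerivWithinAt_shift (h.hasDerivWithinAt (t + s)
      ⟨by linarith [hs.1], by linarith [hs.2]⟩)).mono fun r hr => ?_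
    exact ⟨by linarith [hr.1], by linarith [hr.2]⟩

/-- A solution which starts at the final segment of another solution can be appended to it. -/
theorem IsSol.append (hx : IsSol U f a φ x) (hy : IsSol U f b (seg x a) y) (ha : 0 ≤ a)
    (hb : 0 ≤ b) : IsSol U f (a + b) φ (FrechetDDE.shift y (-a)) := by
  -- on `(-∞, a]` the shifted curve agrees with `x` because `y_0 = x_a`
  have hxz : EqOn x (FrechetDDE.shift y (-a)) (Iic a) :=
    apply_eq_of_seg_eq (by rw [seg_shift, neg_add_cancel, hy.seg_zero])
  have hx' := hx.congr ha hxz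
  refine ⟨hx'.seg_zero, fun t ht => ?_, fun t ht => ?_⟩
  · rcases le_total t a with h | h
    · exact hx'.seg_mem t ⟨ht.1, h⟩
    · rw [seg_shift]
      exact hy.seg_mem _ ⟨by linarith, by linarith [ht.2]⟩
  · have h1 : HasDerivWithinAt (FrechetDDE.shift y (-a)) (f (seg (FrechetDDE.shift y (-a)) t))
        (Icc 0 a) t := by
      rcases le_or_gt t a with h | h
      · exact hx'.hasDerivWithinAt t ⟨ht.1, h⟩
      · refine HasFDerivWithinAt.of_notMem_closure ?_
        rw [isClosed_Icc.closure_eq]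
        exact fun h' => h.not_ge h'.2
    have h2 : HasDerivWithinAt (FrechetDDE.shift y (-a)) (f (seg (FrechetDDE.shift y (-a)) t))
        (Icc a (a + b)) t := by
      rcases le_or_gt a t with h | h
      · rw [seg_shift]
        refine (hasDerivWithinAt_shift (hy.hasDerivWithinAt (-a + t)
          ⟨by linarith, by linarith [ht.2]⟩)).mono fun r hr => ?_
        exact ⟨by linarith [hr.1], by linarith [hr.2]⟩
      · refine HasFDerivWithinAt.of_notMem_closure ?_
        rw [isClosed_Icc.closure_eq]
        exact fun h' => h.not_ge h'.1
    rw [← Icc_union_Icc_eq_Icc ha (by linarith : a ≤ a + b)]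
    exact h1.union h2

theorem eq_zero_of_forall_histSeminorm_le_zero {φ : History E}
    (h : ∀ S, histSeminorm S φ ≤ 0) : φ = 0 := by
  ext1 s
  have := (norm_le_histSeminorm φ (T := -s) (s := s) (by simp)).trans (h _)
  simpa using this

theorem IsSol.exists_seg_eq (h : IsC1With U f D) (hx : IsSol U f a φ x) (hy : IsSol U f a φ y)
    (ha : 0 < a) : ∃ b, 0 < b ∧ ∀ t ∈ Icc 0 b, seg x t = seg y t := by
  have hφ := hx.mem ha.le
  obtain ⟨T, δ, c, ht⟩ := h.exists_isLipschitzTube (isCompact_singleton (x := φ))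
    (singleton_subset_iff.2 hφ)
  have hnear : ∀ z : C(ℝ, E), seg z 0 = φ → ∀ᶠ t in 𝓝 0, histSeminorm T (seg z t - φ) < δ := by
    intro z hz
    have := (continuous_seg z).tendsto 0
    rw [hz, tendsto_iff_histSeminorm] at this
    exact this T ht.T_nonneg δ ht.δ_pos
  obtain ⟨ε, hε, hb⟩ := Metric.eventually_nhds_iff.1
    ((hnear x hx.seg_zero).and (hnear y hy.seg_zero))
  refine ⟨min a (ε / 2), by positivity, fun t htt => ?_⟩
  have hb' : ∀ t ∈ Icc 0 (min a (ε / 2)), histSeminorm T (seg x t - φ) < δ ∧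
      histSeminorm T (seg y t - φ) < δ := fun t ht => hb (by
    rw [Real.dist_eq, sub_zero, abs_of_nonneg ht.1]
    linarith [ht.2.trans (min_le_right _ _)])
  have hle : min a (ε / 2) ≤ a := min_le_left _ _
  have key := histSeminorm_seg_le_gronwallConst (d := x - y) (T := T) (η := 0)
    (d' := fun t => f (seg x t) - f (seg y t)) ht.c_nonneg le_rfl ht.T_nonneg
    (fun s hs => ((hx.mono hle).hasDerivWithinAt s hs).sub ((hy.mono hle).hasDerivWithinAt s hs))
    (fun s hs => by
      have := ht.lipschitz φ rfl _ _ (hb' s hs).1 (hb' s hs).2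
      rwa [add_sub_cancel, add_sub_cancel, sub_sub_sub_cancel_right, ← seg_sub, ← add_zero (c * _)]
        at this)
  rw [← sub_eq_zero, ← seg_sub]
  refine eq_zero_of_forall_histSeminorm_le_zero fun S => (key S t htt).trans (le_of_eq ?_)
  rw [seg_sub, hx.seg_zero, hy.seg_zero]
  simp

theorem IsSol.eqOn (h : IsC1With U f D) (hx : IsSol U f a φ x) (hy : IsSol U f a φ y) (ha : 0 ≤ a) :
    EqOn x y (Iic a) := by
  refine apply_eq_of_seg_eq ?_
  have hsub : Icc 0 a ⊆ {t | seg x t = seg y t} := by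
    refine IsClosed.Icc_subset_of_forall_mem_nhdsWithin ?_ ?_ ?_
    · exact (isClosed_eq (continuous_seg x) (continuous_seg y)).inter isClosed_Icc
    · exact hx.seg_zero.trans hy.seg_zero.symm
    · rintro t ⟨htS, ht⟩
      have hy' := hy.shift ht.1
      rw [← show seg x t = seg y t from htS] at hy'
      obtain ⟨b, hb, H⟩ := IsSol.exists_seg_eq h (hx.shift ht.1) hy' (sub_pos.2 ht.2)
      refine mem_of_superset (Ioc_mem_nhdsGT (lt_add_of_pos_right t hb)) fun s hs => ?_
      have := H (s - t) ⟨by linarith [hs.1], by linarith [hs.2]⟩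
      rwa [seg_shift, seg_shift, add_sub_cancel] at this
  exact hsub ⟨ha, le_rfl⟩

theorem IsSol.seg_eq (h : IsC1With U f D) (hx : IsSol U f a φ x) (hy : IsSol U f b φ y) {t : ℝ}
    (ht : 0 ≤ t) (hta : t ≤ a) (htb : t ≤ b) : seg x t = seg y t :=
  seg_congr (IsSol.eqOn h (hx.mono hta) (hy.mono htb) ht)

/-- Inside the tube of radius `r` the truncation does not change `f`: it changes histories at most
on `(-∞, -T)`, where `f` does not see them. -/
theorem IsLipschitzTube.map_truncHistory {K : Set (History E)} {T δ c r : ℝ}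
    (h : IsLipschitzTube U f D K T δ c) (hr : 0 < r) (hrδ : r < δ) {u z : History E} (hu : u ∈ K)
    (hz : histSeminorm T z ≤ r) : f (u + truncHistory hr z) = f (u + z) := by
  have := h.lipschitz u hu _ _ ((histSeminorm_truncHistory_le hr T z).trans_lt hrδ)
    (hz.trans_lt hrδ)
  rw [histSeminorm_truncHistory_sub_self hr hz, mul_zero] at this
  exact sub_eq_zero.1 (norm_le_zero_iff.1 this)

variable [CompleteSpace E]

/-- Global solutions of the equation whose right-hand side is modified outside the tube of radius
`r` around a curve `g` of histories. -/
theorem IsLipschitzTube.exists_truncated_solution {T δ c r : ℝ} {g : ℝ → History E}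
    (ht : IsLipschitzTube U f D (g '' Icc 0 a) T δ c) (hf : ContinuousOn f U) (hg : Continuous g)
    (ha : 0 ≤ a) (hr : 0 < r) (hrδ : r < δ) (φ : History E) :
    ∃ y : C(ℝ, E), seg y 0 = φ ∧ ∀ t ∈ Icc 0 a,
      HasDerivWithinAt y (f (g t + truncHistory hr (seg y t - g t))) (Icc 0 a) t := by
  have hlt : ∀ z : History E, histSeminorm T (truncHistory hr z) < δ := fun z =>
    (histSeminorm_truncHistory_le hr T z).trans_lt hrδ
  refine exists_solution_of_lipschitz (G := fun t u => f (g t + truncHistory hr (u - g t)))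
    (c := c * 2) (T := T) ha (mul_nonneg ht.c_nonneg two_pos.le) ?_ (fun s hs u w => ?_) φ
  · refine hf.comp (Continuous.continuousOn ?_) ?_
    · exact (hg.comp continuous_fst).add ((continuous_truncHistory hr).comp
        (continuous_snd.sub (hg.comp continuous_fst)))
    · rintro ⟨t, u⟩ ⟨ht', -⟩
      exact ht.mem _ ⟨t, ht', rfl⟩ _ (hlt _)
  · refine (ht.lipschitz _ ⟨s, hs, rfl⟩ _ _ (hlt _) (hlt _)).trans ?_
    rw [mul_assoc]
    refine mul_le_mul_of_nonneg_left ?_ ht.c_nonneg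
    refine (histSeminorm_truncHistory_sub_le hr T _ _).trans_eq ?_
    rw [sub_sub_sub_cancel_right]

theorem exists_isSol (h : IsC1With U f D) (hφ : φ ∈ U) : ∃ a, 0 < a ∧ ∃ x, IsSol U f a φ x := by
  obtain ⟨T, δ, c, ht⟩ := h.exists_isLipschitzTube (isCompact_singleton (x := φ))
    (singleton_subset_iff.2 hφ)
  have hr : 0 < δ / 2 := half_pos ht.δ_pos
  have hrδ : δ / 2 < δ := half_lt_self ht.δ_pos
  obtain ⟨y, hy0, hy⟩ := IsLipschitzTube.exists_truncated_solution (g := fun _ => φ) (a := 1)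
    (ht.mono (by rintro _ ⟨_, _, rfl⟩; rfl)) h.continuousOn continuous_const zero_le_one hr hrδ φ
  have hnear : ∀ᶠ t in 𝓝 0, histSeminorm T (seg y t - φ) < δ / 2 := by
    have := (continuous_seg y).tendsto 0
    rw [hy0, tendsto_iff_histSeminorm] at this
    exact this T ht.T_nonneg _ hr
  obtain ⟨ε, hε, hb⟩ := Metric.eventually_nhds_iff.1 hnear
  refine ⟨min 1 (ε / 2), by positivity, y, hy0, fun t htt => ?_, fun t htt => ?_⟩ <;>
  have hlt : histSeminorm T (seg y t - φ) < δ / 2 := hb (by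
    rw [Real.dist_eq, sub_zero, abs_of_nonneg htt.1]
    linarith [htt.2.trans (min_le_right _ _)])
  · simpa using ht.mem φ rfl _ (hlt.trans hrδ)
  · have h1 := hy t ⟨htt.1, htt.2.trans (min_le_left _ _)⟩
    rw [ht.map_truncHistory hr hrδ rfl hlt.le, add_sub_cancel] at h1
    exact h1.mono (Icc_subset_Icc_right (min_le_left _ _))

theorem IsSol.exists_extension (h : IsC1With U f D) (hx : IsSol U f a φ x) (ha : 0 ≤ a) :
    ∃ b, a < b ∧ ∃ y, IsSol U f b φ y := by
  obtain ⟨b, hb, y, hy⟩ := exists_isSol h (hx.seg_mem a ⟨ha, le_rfl⟩)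
  exact ⟨a + b, by linarith, _, hx.append hy ha hb.le⟩

/-- Solutions depend Lipschitz continuously on the initial history. In particular the existence
interval does not shrink under small perturbations. -/
theorem IsSol.exists_nearby (h : IsC1With U f D) (hx : IsSol U f a φ x) (ha : 0 ≤ a) :
    ∃ T δ C : ℝ, 0 ≤ T ∧ 0 < δ ∧ 0 ≤ C ∧ ∀ ψ : History E, histSeminorm T (ψ - φ) < δ →
      ∃ y, IsSol U f a ψ y ∧ ∀ S, ∀ t ∈ Icc 0 a,
        histSeminorm S (seg y t - seg x t) ≤
          histSeminorm S (ψ - φ) + C * histSeminorm T (ψ - φ) := by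
  obtain ⟨T, δ, c, ht⟩ := h.exists_isLipschitzTube (isCompact_image_seg x a)
    hx.image_seg_subset
  have hr : 0 < δ / 2 := half_pos ht.δ_pos
  have hrδ : δ / 2 < δ := half_lt_self ht.δ_pos
  have hc2 : 0 ≤ c * 2 := mul_nonneg ht.c_nonneg two_pos.le
  set C := gronwallConst a (c * 2) with hC
  have hC0 : 0 ≤ C := gronwallConst_nonneg ha hc2
  refine ⟨T, δ / 2 / (1 + C), C, ht.T_nonneg, by positivity, hC0, fun ψ hψ => ?_⟩
  obtain ⟨y, hy0, hy⟩ := ht.exists_truncated_solution h.continuousOn (continuous_seg x) ha hr hrδ ψ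
  have key : ∀ S, ∀ t ∈ Icc 0 a, histSeminorm S (seg y t - seg x t) ≤
      histSeminorm S (ψ - φ) + C * histSeminorm T (ψ - φ) := by
    have h1 := histSeminorm_seg_le_gronwallConst (d := y - x) (T := T) (η := 0) hc2 le_rfl
      ht.T_nonneg (fun s hs => (hy s hs).sub (hx.hasDerivWithinAt s hs)) (fun s hs => by
        have h2 := ht.lipschitz _ ⟨s, hs, rfl⟩ _ 0 ((histSeminorm_truncHistory_le hr T
          (seg y s - seg x s)).trans_lt hrδ) (by simpa using ht.δ_pos)
        rw [add_zero, ← truncHistory_zero hr] at h2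
        rw [add_zero, mul_assoc, seg_sub]
        refine h2.trans (mul_le_mul_of_nonneg_left ?_ ht.c_nonneg)
        simpa using histSeminorm_truncHistory_sub_le hr T (seg y s - seg x s) 0)
    simpa only [seg_sub, hy0, hx.seg_zero, add_zero] using h1
  have hnear : ∀ t ∈ Icc 0 a, histSeminorm T (seg y t - seg x t) < δ / 2 := by
    intro t htt
    rw [lt_div_iff₀ (by positivity)] at hψ
    linarith [key T t htt]
  refine ⟨y, ⟨hy0, fun t htt => ?_, fun t htt => ?_⟩, key⟩
  · simpa using ht.mem _ ⟨t, htt, rfl⟩ _ ((hnear t htt).trans hrδ)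
  · have h1 := hy t htt
    rwa [ht.map_truncHistory hr hrδ ⟨t, htt, rfl⟩ (hnear t htt).le, add_sub_cancel] at h1

end Solutions

/-! ### The variational equation and smoothness of solution operators -/

section Variational

variable {E : Type*} [NormedAddCommGroup E] [NormedSpace ℝ E]
  {U : Set (History E)} {f : History E → E} {D : History E → History E → E} {a : ℝ}
  {φ χ χ' : History E} {x y e e' : C(ℝ, E)}

/-- `e` solves the variational equation `e'(t) = D(x_t) e_t` along `x` on `[0, a]` with
`e_0 = χ`. -/
structure IsVarSol (D : History E → History E → E) (a : ℝ) (x : C(ℝ, E)) (χ : History E)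
    (e : C(ℝ, E)) : Prop where
  seg_zero : seg e 0 = χ
  hasDerivWithinAt : ∀ t ∈ Icc 0 a, HasDerivWithinAt e (D (seg x t) (seg e t)) (Icc 0 a) t

theorem IsC1With.deriv_zero (h : IsC1With U f D) {u : History E} (hu : u ∈ U) : D u 0 = 0 :=
  (h.hasDirectionalDeriv u hu 0).unique
    (by simpa using (h.hasDirectionalDeriv u hu 0).const_smul 0)

theorem IsC1With.isVarSol_zero (h : IsC1With U f D) (hx : IsSol U f a φ x) :
    IsVarSol D a x 0 0 := by
  refine ⟨rfl, fun t ht => ?_⟩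
  rw [show seg (0 : C(ℝ, E)) t = 0 from rfl, h.deriv_zero (hx.seg_mem t ht)]
  exact hasDerivWithinAt_const t _ (0 : E)

theorem IsVarSol.add {D : History E → History E →L[ℝ] E}
    (he : IsVarSol (fun u v => D u v) a x χ e) (he' : IsVarSol (fun u v => D u v) a x χ' e') :
    IsVarSol (fun u v => D u v) a x (χ + χ') (e + e') := by
  refine ⟨by rw [seg_add, he.seg_zero, he'.seg_zero], fun t ht => ?_⟩
  simpa [seg_add] using (he.hasDerivWithinAt t ht).add (he'.hasDerivWithinAt t ht)

theorem IsVarSol.smul {D : History E → History E →L[ℝ] E}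
    (he : IsVarSol (fun u v => D u v) a x χ e) (r : ℝ) :
    IsVarSol (fun u v => D u v) a x (r • χ) (r • e) := by
  refine ⟨by rw [seg_smul, he.seg_zero], fun t ht => ?_⟩
  simpa [seg_smul] using (he.hasDerivWithinAt t ht).const_smul r

/-- Comparison of solutions of the variational equations along two nearby curves. -/
theorem IsVarSol.histSeminorm_sub_le {T δ c η : ℝ}
    (ht : IsLipschitzTube U f D (seg x '' Icc 0 a) T δ c)
    (hxy : ∀ t ∈ Icc 0 a, histSeminorm T (seg y t - seg x t) < δ) (he : IsVarSol D a x χ e)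
    (he' : IsVarSol D a y χ' e') (hη : 0 ≤ η)
    (hD : ∀ t ∈ Icc 0 a, ‖D (seg y t) (seg e t) - D (seg x t) (seg e t)‖ ≤ η) (S : ℝ) :
    ∀ t ∈ Icc 0 a, histSeminorm S (seg e' t - seg e t) ≤
      histSeminorm S (χ' - χ) + gronwallConst a c * (histSeminorm T (χ' - χ) + η) := by
  have key := histSeminorm_seg_le_gronwallConst (d := e' - e) ht.c_nonneg hη ht.T_nonneg
    (fun s hs => (he'.hasDerivWithinAt s hs).sub (he.hasDerivWithinAt s hs)) (fun s hs => by
      have h1 := ht.deriv_lipschitz _ ⟨s, hs, rfl⟩ _ (hxy s hs) (seg e' s) (seg e s)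
      rw [add_sub_cancel] at h1
      rw [seg_sub]
      refine (norm_sub_le_norm_sub_add_norm_sub _ (D (seg y s) (seg e s)) _).trans ?_
      exact add_le_add h1 (hD s hs)) S
  simpa only [seg_sub, he.seg_zero, he'.seg_zero] using key

theorem IsVarSol.seg_eq (h : IsC1With U f D) (hx : IsSol U f a φ x) (he : IsVarSol D a x χ e)
    (he' : IsVarSol D a x χ e') : ∀ t ∈ Icc 0 a, seg e' t = seg e t := by
  obtain ⟨T, δ, c, ht⟩ := h.exists_isLipschitzTube (isCompact_image_seg x a) hx.image_seg_subset
  intro t htt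
  refine sub_eq_zero.1 (eq_zero_of_forall_histSeminorm_le_zero fun S => ?_)
  refine (he.histSeminorm_sub_le ht (fun t _ => by simpa using ht.δ_pos) he' le_rfl
    (fun t _ => by simp) S t htt).trans ?_
  simp

theorem IsC1With.exists_isVarSol [CompleteSpace E] (h : IsC1With U f D) (hx : IsSol U f a φ x)
    (ha : 0 ≤ a) (χ : History E) : ∃ e, IsVarSol D a x χ e := by
  obtain ⟨T, δ, c, ht⟩ := h.exists_isLipschitzTube (isCompact_image_seg x a) hx.image_seg_subset
  have hG : ContinuousOn (fun p : ℝ × History E => D (seg x p.1) p.2) (Icc 0 a ×ˢ univ) := by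
    refine h.continuousOn_deriv.comp (f := fun p : ℝ × History E => (seg x p.1, p.2))
      (Continuous.continuousOn ?_) fun p hp => ⟨hx.seg_mem _ hp.1, mem_univ _⟩
    exact ((continuous_seg x).comp continuous_fst).prodMk continuous_snd
  obtain ⟨e, he0, he⟩ := exists_solution_of_lipschitz (G := fun t v => D (seg x t) v) (T := T) ha
    ht.c_nonneg hG (fun s hs u w => by
      simpa using ht.deriv_lipschitz _ ⟨s, hs, rfl⟩ 0 (by simpa using ht.δ_pos) u w) χ
  exact ⟨e, he0, he⟩

variable [CompleteSpace E]

theorem IsSol.eventually_exists (h : IsC1With U f D) (hx : IsSol U f a φ x) (ha : 0 ≤ a) :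
    ∀ᶠ ψ in 𝓝 φ, ∃ y, IsSol U f a ψ y := by
  obtain ⟨T, δ, C, hT, hδ, -, H⟩ := hx.exists_nearby h ha
  exact mem_nhds_iff_histSeminorm.2 ⟨T, δ, hT, hδ, fun ψ hψ => (H ψ hψ).imp fun _ hy => hy.1⟩

theorem IsSol.eventually_near (h : IsC1With U f D) (hx : IsSol U f a φ x) (ha : 0 ≤ a) (S : ℝ)
    {ε : ℝ} (hε : 0 < ε) : ∀ᶠ ψ in 𝓝 φ, ∀ y, IsSol U f a ψ y → ∀ t ∈ Icc 0 a,
      histSeminorm S (seg y t - seg x t) < ε := by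
  obtain ⟨T, δ, C, hT, hδ, hC, H⟩ := hx.exists_nearby h ha
  have h1 : ∀ᶠ ψ in 𝓝 φ, histSeminorm T (ψ - φ) < δ :=
    mem_nhds_iff_histSeminorm.2 ⟨T, δ, hT, hδ, fun _ hψ => hψ⟩
  have h2 : Tendsto (fun ψ => histSeminorm S (ψ - φ) + C * histSeminorm T (ψ - φ)) (𝓝 φ) (𝓝 0) := by
    refine Continuous.tendsto' ?_ _ _ (by simp)
    have h3 : Continuous fun ψ => ψ - φ := by fun_prop
    exact ((continuous_histSeminorm S).comp h3).add
      (continuous_const.mul ((continuous_histSeminorm T).comp h3))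
  filter_upwards [h1, h2 (Iio_mem_nhds hε)] with ψ h4 h5 y hy t ht
  obtain ⟨z, hz, hzx⟩ := H ψ h4
  rw [hy.seg_eq h hz ht.1 ht.2 ht.2]
  exact (hzx S t ht).trans_lt h5

/-- The solution operator at time `a` has the directional derivatives given by the variational
equation. The difference quotient `h⁻¹ (y - x)`, where `y` is the solution starting at `φ + h χ`,
solves the variational equation up to an error which is small uniformly on `[0, a]`. -/
theorem IsVarSol.hasDirectionalDeriv (h : IsC1With U f D) (hx : IsSol U f a φ x) (ha : 0 ≤ a)
    {Φ : History E → History E} (hΦ : ∀ ψ y, IsSol U f a ψ y → Φ ψ = seg y a)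
    (he : IsVarSol D a x χ e) : HasDirectionalDeriv Φ φ χ (seg e a) := by
  obtain ⟨T, δ, c, ht⟩ := h.exists_isLipschitzTube (isCompact_image_seg x a) hx.image_seg_subset
  have hC : 0 ≤ gronwallConst a c := gronwallConst_nonneg ha ht.c_nonneg
  refine tendsto_iff_histSeminorm.2 fun S hS ε hε => ?_
  set η : ℝ := ε / (2 * (gronwallConst a c + 1)) with hη
  have hη0 : 0 < η := by positivity
  have hK : IsCompact ((fun t => (seg x t, seg e t)) '' Icc 0 a) :=
    isCompact_Icc.image ((continuous_seg x).prodMk (continuous_seg e))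
  obtain ⟨T', δ', -, hδ', hslope⟩ := exists_norm_slope_sub_le h.isOpen h.hasDirectionalDeriv
    h.continuousOn_deriv hK (by rintro _ ⟨t, ht, rfl⟩; exact hx.seg_mem t ht) hη0
  have hbdd : ∀ R ε, 0 < ε → ∀ᶠ r : ℝ in 𝓝 0, ∀ t ∈ Icc 0 a,
      |r| * histSeminorm R (seg e t) < ε := by
    intro R ε hε
    obtain ⟨M, hM⟩ := (isCompact_Icc (a := (0 : ℝ)) (b := a)).bddAbove_image
      ((continuous_histSeminorm R).comp (continuous_seg e)).continuousOn
    have h1 : Tendsto (fun r : ℝ => |r| * M) (𝓝 0) (𝓝 0) :=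
      Continuous.tendsto' (by fun_prop) _ _ (by simp)
    filter_upwards [h1 (Iio_mem_nhds hε)] with r hr t ht
    exact (mul_le_mul_of_nonneg_left (hM ⟨t, ht, rfl⟩) (abs_nonneg r)).trans_lt hr
  have hline : Tendsto (fun r : ℝ => φ + r • χ) (𝓝 0) (𝓝 φ) :=
    Continuous.tendsto' (by fun_prop) _ _ (by simp)
  filter_upwards [self_mem_nhdsWithin, nhdsWithin_le_nhds (hbdd T δ ht.δ_pos),
    nhdsWithin_le_nhds (hbdd T' δ' hδ'), nhdsWithin_le_nhds (hline (hx.eventually_exists h ha)),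
    nhdsWithin_le_nhds (hline (hx.eventually_near h ha T ht.δ_pos))] with r hr h1 h2 h3 h4
  have hr0 : r ≠ 0 := hr
  obtain ⟨y, hy⟩ := h3
  have key := histSeminorm_seg_le_gronwallConst (d := r⁻¹ • (y - x) - e) (T := T) (η := η)
    ht.c_nonneg hη0.le ht.T_nonneg
    (fun s hs => (((hy.hasDerivWithinAt s hs).sub (hx.hasDerivWithinAt s hs)).const_smul r⁻¹).sub
      (he.hasDerivWithinAt s hs)) (fun s hs => by
      have h5 := ht.lipschitz _ ⟨s, hs, rfl⟩ _ (r • seg e s) (h4 y hy s hs)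
        (by rw [map_smul_eq_mul]; exact h1 s hs)
      rw [add_sub_cancel] at h5
      have h6 := hslope _ ⟨s, hs, rfl⟩ r hr0 (h2 s hs)
      have h7 : r⁻¹ • (f (seg y s) - f (seg x s)) - D (seg x s) (seg e s) =
          r⁻¹ • (f (seg y s) - f (seg x s + r • seg e s)) +
            (r⁻¹ • (f (seg x s + r • seg e s) - f (seg x s)) - D (seg x s) (seg e s)) := by
        module
      have h8 : seg (r⁻¹ • (y - x) - e) s = r⁻¹ • (seg y s - seg x s - r • seg e s) := by
        rw [seg_sub, seg_smul, seg_sub, smul_sub r⁻¹ _ (r • _), smul_smul, inv_mul_cancel₀ hr0,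
          one_smul]
      rw [h7, h8, map_smul_eq_mul]
      refine (norm_add_le _ _).trans (add_le_add ?_ h6)
      rw [norm_smul, mul_left_comm]
      gcongr) S a ⟨ha, le_rfl⟩
  have h0 : seg (r⁻¹ • (y - x) - e) 0 = 0 := by
    rw [seg_sub, seg_smul, seg_sub, hy.seg_zero, hx.seg_zero, he.seg_zero, add_sub_cancel_left,
      smul_smul, inv_mul_cancel₀ hr0, one_smul, sub_self]
  rw [h0, seg_sub, seg_smul, seg_sub, map_zero, map_zero, zero_add, zero_add] at key
  rw [hΦ _ _ hy, hΦ _ _ hx]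
  refine key.trans_lt ?_
  rw [hη, ← mul_div_assoc, div_lt_iff₀ (by positivity)]
  nlinarith

/-- Solutions of the variational equation depend continuously on the pair of initial histories. -/
theorem IsVarSol.eventually_near (h : IsC1With U f D) (hx : IsSol U f a φ x) (ha : 0 ≤ a)
    (he : IsVarSol D a x χ e) (S : ℝ) {ε : ℝ} (hε : 0 < ε) :
    ∀ᶠ p : History E × History E in 𝓝 (φ, χ), ∀ y e', IsSol U f a p.1 y →
      IsVarSol D a y p.2 e' → histSeminorm S (seg e' a - seg e a) < ε := by
  obtain ⟨T, δ, c, ht⟩ := h.exists_isLipschitzTube (isCompact_image_seg x a) hx.image_seg_subset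
  have hC : 0 ≤ gronwallConst a c := gronwallConst_nonneg ha ht.c_nonneg
  set η : ℝ := ε / (2 * (gronwallConst a c + 1)) with hη
  have hη0 : 0 < η := by positivity
  have hK : IsCompact ((fun t => (seg x t, seg e t)) '' Icc 0 a) :=
    isCompact_Icc.image ((continuous_seg x).prodMk (continuous_seg e))
  obtain ⟨T', δ', -, hδ', hDη⟩ := eventually_forall_dist_deriv_le h.isOpen
    h.continuousOn_deriv hK (by rintro _ ⟨t, ht, rfl⟩; exact hx.seg_mem t ht) hη0
  have h1 : Tendsto (fun p : History E × History E => histSeminorm S (p.2 - χ) +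
      gronwallConst a c * (histSeminorm T (p.2 - χ) + η)) (𝓝 (φ, χ))
      (𝓝 (gronwallConst a c * η)) := by
    refine Continuous.tendsto' ?_ _ _ (by simp)
    have h3 : Continuous fun p : History E × History E => p.2 - χ := by fun_prop
    exact ((continuous_histSeminorm S).comp h3).add
      (continuous_const.mul (((continuous_histSeminorm T).comp h3).add continuous_const))
  have h2 : gronwallConst a c * η < ε := by
    rw [hη, ← mul_div_assoc, div_lt_iff₀ (by positivity)]
    nlinarith
  have hfst : Tendsto Prod.fst (𝓝 (φ, χ)) (𝓝 φ) := continuous_fst.tendsto (φ, χ)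
  filter_upwards [h1 (Iio_mem_nhds h2), hfst (hx.eventually_near h ha T ht.δ_pos),
    hfst (hx.eventually_near h ha T' hδ')] with p h3 h4 h5 y e' hy he'
  refine (he.histSeminorm_sub_le ht (h4 y hy) he' hη0.le (fun t htt => ?_) S a
    ⟨ha, le_rfl⟩).trans_lt h3
  have := (hDη _ (h5 y hy t htt) _ ⟨t, htt, rfl⟩).2
  rwa [add_sub_cancel] at this

theorem isOpen_setOf_exists_isSol (h : IsC1With U f D) (ha : 0 ≤ a) :
    IsOpen {φ | ∃ x, IsSol U f a φ x} :=
  isOpen_iff_mem_nhds.2 fun _ ⟨_, hx⟩ => hx.eventually_exists h ha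

theorem continuousOn_of_isSol (h : IsC1With U f D) (ha : 0 ≤ a)
    {Φ : History E → History E} (hΦ : ∀ ψ y, IsSol U f a ψ y → Φ ψ = seg y a) :
    ContinuousOn Φ {φ | ∃ x, IsSol U f a φ x} := by
  rintro φ ⟨x, hx⟩
  refine tendsto_iff_histSeminorm.2 fun S _ ε hε => ?_
  filter_upwards [self_mem_nhdsWithin, nhdsWithin_le_nhds (hx.eventually_near h ha S hε)]
  rintro ψ ⟨y, hy⟩ h1
  rw [hΦ _ _ hy, hΦ _ _ hx]
  exact h1 y hy a ⟨ha, le_rfl⟩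

theorem isC1MBOn_of_isSol (h : IsC1With U f D) (ha : 0 ≤ a)
    {Φ : History E → History E} (hΦ : ∀ ψ y, IsSol U f a ψ y → Φ ψ = seg y a) :
    IsC1MBOn Φ {φ | ∃ x, IsSol U f a φ x} := by
  have hex : ∀ φ χ : History E, ∃ w, ∀ x, IsSol U f a φ x → ∃ e, IsVarSol D a x χ e ∧
      seg e a = w := by
    intro φ χ
    by_cases hφ : ∃ x, IsSol U f a φ x
    · obtain ⟨x, hx⟩ := hφ
      obtain ⟨e, he⟩ := h.exists_isVarSol hx ha χ
      refine ⟨seg e a, fun y hy => ?_⟩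
      have hxy : ∀ t ∈ Icc 0 a, seg x t = seg y t := fun t ht => hx.seg_eq h hy ht.1 ht.2 ht.2
      exact ⟨e, ⟨he.seg_zero, fun t ht => hxy t ht ▸ he.hasDerivWithinAt t ht⟩, rfl⟩
    · exact ⟨0, fun x hx => (hφ ⟨x, hx⟩).elim⟩
  choose w hw using hex
  refine ⟨continuousOn_of_isSol h ha hΦ, w, ?_, ?_⟩
  · rintro φ ⟨x, hx⟩ χ
    obtain ⟨e, he, hea⟩ := hw φ χ x hx
    exact hea ▸ he.hasDirectionalDeriv h hx ha hΦ
  · rintro ⟨φ, χ⟩ ⟨⟨x, hx⟩, -⟩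
    refine tendsto_iff_histSeminorm.2 fun S _ ε hε => ?_
    obtain ⟨e, he, hea⟩ := hw φ χ x hx
    filter_upwards [self_mem_nhdsWithin, nhdsWithin_le_nhds (he.eventually_near h hx ha S hε)]
    rintro ⟨ψ, ξ⟩ ⟨⟨y, hy⟩, -⟩ h1
    obtain ⟨e', he', hea'⟩ := hw ψ ξ y hy
    simp only
    rw [← hea, ← hea']
    exact h1 y e' hy he'

theorem exists_clm_of_isVarSol {D : History E → History E →L[ℝ] E}
    (h : IsC1With U f fun u v => D u v) (hx : IsSol U f a φ x) (ha : 0 ≤ a) :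
    ∃ L : History E →L[ℝ] History E, ∀ χ e, IsVarSol (fun u v => D u v) a x χ e →
      seg e a = L χ := by
  choose e he using h.exists_isVarSol hx ha
  have huniq : ∀ {χ e'}, IsVarSol (fun u v => D u v) a x χ e' → seg e' a = seg (e χ) a :=
    fun {χ e'} he' => (he χ).seg_eq h hx he' a ⟨ha, le_rfl⟩
  refine ⟨⟨⟨⟨fun χ => seg (e χ) a, fun χ χ' => ?_⟩, fun r χ => ?_⟩, ?_⟩, fun χ e' he' => huniq he'⟩
  · exact (huniq ((he χ).add (he χ'))).symm
  · exact (huniq ((he χ).smul r)).symm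
  · refine continuous_iff_continuousAt.2 fun χ => tendsto_iff_histSeminorm.2 fun S _ ε hε => ?_
    have h1 : Tendsto (fun χ' => (φ, χ')) (𝓝 χ) (𝓝 (φ, χ)) := by
      exact (Continuous.prodMk_right φ).tendsto χ
    filter_upwards [h1 ((he χ).eventually_near h hx ha S hε)] with χ' h2
    exact h2 x (e χ') hx (he χ')

/-- For Fréchet smooth `f`, the solutions of the variational equation depend continuously on the
base point, uniformly for initial directions in a bounded set. The segments of the solutions
starting in a bounded set form a bounded set, due to the Gronwall estimate. -/
theorem IsVarSol.eventually_near_of_bounded {D : History E → History E →L[ℝ] E}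
    (h : IsC1With U f fun u v => D u v) (hD : ContinuousOn D U) (hx : IsSol U f a φ x) (ha : 0 ≤ a)
    {B : Set (History E)} (hB : Bornology.IsVonNBounded ℝ B) (S : ℝ) {ε : ℝ} (hε : 0 < ε) :
    ∀ᶠ ψ in 𝓝 φ, ∀ y, IsSol U f a ψ y → ∀ χ ∈ B, ∀ e e', IsVarSol (fun u v => D u v) a x χ e →
      IsVarSol (fun u v => D u v) a y χ e' → histSeminorm S (seg e' a - seg e a) < ε := by
  obtain ⟨T, δ, c, ht⟩ := h.exists_isLipschitzTube (isCompact_image_seg x a) hx.image_seg_subset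
  have hC : 0 ≤ gronwallConst a c := gronwallConst_nonneg ha ht.c_nonneg
  set η : ℝ := ε / (2 * (gronwallConst a c + 1)) with hη
  have hη0 : 0 < η := by positivity
  let B' : Set (History E) :=
    {v | ∃ χ ∈ B, ∃ e, IsVarSol (fun u v => D u v) a x χ e ∧ ∃ t ∈ Icc 0 a, seg e t = v}
  have hB' : Bornology.IsVonNBounded ℝ B' := by
    rw [withSeminorms_histSeminorm.isVonNBounded_iff_seminorm_bounded] at hB ⊢
    intro R
    obtain ⟨r, hr, h1⟩ := hB R
    obtain ⟨r', hr', h2⟩ := hB T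
    refine ⟨r + gronwallConst a c * r', by positivity, ?_⟩
    rintro _ ⟨χ, hχ, e, he, t, htt, rfl⟩
    have h3 := (h.isVarSol_zero hx).histSeminorm_sub_le ht (fun t _ => by simpa using ht.δ_pos) he
      le_rfl (fun t _ => by simp) R t htt
    simp only [show seg (0 : C(ℝ, E)) t = 0 from rfl, sub_zero, add_zero] at h3
    have h4 := mul_le_mul_of_nonneg_left (h2 χ hχ).le hC
    linarith [h1 χ hχ]
  obtain ⟨T', δ', -, hδ', hDη⟩ := eventually_forall_dist_deriv_le_of_bounded h.isOpen hD
    (isCompact_image_seg x a) hx.image_seg_subset hB' hη0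
  filter_upwards [hx.eventually_near h ha T ht.δ_pos, hx.eventually_near h ha T' hδ']
    with ψ h4 h5 y hy χ hχ e e' he he'
  refine (he.histSeminorm_sub_le ht (h4 y hy) he' hη0.le (fun t htt => ?_) S a
    ⟨ha, le_rfl⟩).trans_lt ?_
  · have := (hDη _ (h5 y hy t htt) _ ⟨t, htt, rfl⟩).2 (seg e t) ⟨χ, hχ, e, he, t, htt, rfl⟩
    rwa [add_sub_cancel] at this
  · rw [sub_self, map_zero, map_zero, zero_add, zero_add, hη, ← mul_div_assoc,
      div_lt_iff₀ (by positivity)]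
    nlinarith

theorem isC1FOn_of_isSol {D : History E → History E →L[ℝ] E}
    (h : IsC1With U f fun u v => D u v) (hD : ContinuousOn D U) (ha : 0 ≤ a)
    {Φ : History E → History E} (hΦ : ∀ ψ y, IsSol U f a ψ y → Φ ψ = seg y a) :
    IsC1FOn Φ {φ | ∃ x, IsSol U f a φ x} := by
  have hex : ∀ φ : History E, ∃ L : History E →L[ℝ] History E, ∀ x, IsSol U f a φ x → ∀ χ,
      ∃ e, IsVarSol (fun u v => D u v) a x χ e ∧ seg e a = L χ := by
    intro φ
    by_cases hφ : ∃ x, IsSol U f a φ x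
    · obtain ⟨x, hx⟩ := hφ
      obtain ⟨L, hL⟩ := exists_clm_of_isVarSol h hx ha
      refine ⟨L, fun y hy χ => ?_⟩
      obtain ⟨e, he⟩ := h.exists_isVarSol hx ha χ
      have hxy : ∀ t ∈ Icc 0 a, seg x t = seg y t := fun t ht => hx.seg_eq h hy ht.1 ht.2 ht.2
      exact ⟨e, ⟨he.seg_zero, fun t ht => hxy t ht ▸ he.hasDerivWithinAt t ht⟩, hL χ e he⟩
    · exact ⟨0, fun x hx => (hφ ⟨x, hx⟩).elim⟩
  choose L hL using hex
  refine ⟨continuousOn_of_isSol h ha hΦ, L, ?_, ?_⟩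
  · rintro φ ⟨x, hx⟩ χ
    obtain ⟨e, he, hea⟩ := hL φ x hx χ
    exact hea ▸ he.hasDirectionalDeriv h hx ha hΦ
  · rintro φ ⟨x, hx⟩
    rw [ContinuousWithinAt, ← tendsto_sub_nhds_zero_iff,
      ContinuousLinearMap.hasBasis_nhds_zero.tendsto_right_iff]
    rintro ⟨B, V⟩ ⟨hB, hV⟩
    obtain ⟨S, ε, -, hε, hSV⟩ := mem_nhds_zero_iff_histSeminorm.1 hV
    filter_upwards [self_mem_nhdsWithin, nhdsWithin_le_nhds
      (IsVarSol.eventually_near_of_bounded h hD hx ha hB S hε)]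
    rintro ψ ⟨y, hy⟩ h1 χ hχ
    obtain ⟨e, he, hea⟩ := hL φ x hx χ
    obtain ⟨e', he', hea'⟩ := hL ψ y hy χ
    refine hSV _ ?_
    rw [sub_apply, ← hea, ← hea']
    exact h1 y hy χ hχ e e' he he'

end Variational

/-! ### The maximal solutions and the semiflow -/

section Semiflow

variable {n : ℕ} {U : Set (HistorySpace n)} {f : HistorySpace n → EuclideanSpace ℝ (Fin n)}
  {D : HistorySpace n → HistorySpace n → EuclideanSpace ℝ (Fin n)} {a t : ℝ} {φ : HistorySpace n}
  {x : C(ℝ, EuclideanSpace ℝ (Fin n))}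

theorem historySegment_eq_seg {y : ℝ → EuclideanSpace ℝ (Fin n)} (h : EqOn y x (Iic t)) :
    historySegment y t = seg x t := by
  have h1 : (fun s : Iic (0 : ℝ) => y (t + s)) = seg x t := by
    funext s
    exact h (show t + (s : ℝ) ≤ t by linarith [show (s : ℝ) ≤ 0 from s.2])
  have h2 : Continuous (fun s : Iic (0 : ℝ) => y (t + s)) := h1 ▸ (seg x t).continuous
  rw [historySegment, dif_pos h2]
  ext1 s
  exact congrFun h1 s

theorem IsSol.isSolutionOn (h : IsSol U f a φ x) :
    IsSolutionOn U f (Icc 0 a) x ∧ historySegment x 0 = φ := by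
  have hs : ∀ t, historySegment x t = seg x t := fun t => historySegment_eq_seg fun _ _ => rfl
  refine ⟨⟨x.continuous.continuousOn, fun t ht => ?_⟩, (hs 0).trans h.seg_zero⟩
  rw [hs]
  exact ⟨h.seg_mem t ht, h.hasDerivWithinAt t ht⟩

/-- Solutions on an interval yield curves on `ℝ`, by constant extension beyond `a`. -/
theorem IsSolutionOn.exists_isSol {I : Set ℝ} {y : ℝ → EuclideanSpace ℝ (Fin n)}
    (hy : IsSolutionOn U f I y) (hI : I.OrdConnected) (h0 : 0 ∈ I) (hy0 : historySegment y 0 = φ)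
    (ha : 0 ≤ a) (haI : a ∈ I) : ∃ x : C(ℝ, EuclideanSpace ℝ (Fin n)), IsSol U f a φ x ∧
      EqOn y x (Iic a) := by
  have hc : Continuous fun r => y (min r a) := by
    refine hy.1.comp_continuous (by fun_prop) fun r => ?_
    exact ⟨min r a - a, mem_Iic.2 (sub_nonpos.2 (min_le_right _ _)), a, haI, sub_add_cancel _ _⟩
  have hyx : EqOn y (⟨_, hc⟩ : C(ℝ, EuclideanSpace ℝ (Fin n))) (Iic a) := fun r hr => by
    simp [min_eq_left (show r ≤ a from hr)]
  have hs : ∀ t ≤ a, historySegment y t = seg ⟨_, hc⟩ t := fun t ht =>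
    historySegment_eq_seg (hyx.mono (Iic_subset_Iic.2 ht))
  have hsub : Icc 0 a ⊆ I := hI.out h0 haI
  refine ⟨_, ⟨(hs 0 ha).symm.trans hy0, fun t ht => ?_, fun t ht => ?_⟩, hyx⟩
  · rw [← hs t ht.2]
    exact (hy.2 t (hsub ht)).1
  · rw [← hs t ht.2]
    exact ((hy.2 t (hsub ht)).2.mono hsub).congr (fun s hs => (hyx hs.2).symm) (hyx ht.2).symm

/-- The supremum defining `t_φ` is not attained, as solutions on `[0, t]` can be extended. -/
theorem lt_escapeTime_iff (h : IsC1With U f D) (ht : 0 ≤ t) :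
    (t : EReal) < escapeTime U f φ ↔ ∃ x, IsSol U f t φ x := by
  constructor
  · intro hlt
    obtain ⟨_, ⟨s, ⟨hs, y, hy, hy0⟩, rfl⟩, hts⟩ := lt_sSup_iff.1 hlt
    obtain ⟨x, hx, -⟩ := hy.exists_isSol ordConnected_Icc (left_mem_Icc.2 hs.le) hy0 hs.le
      (right_mem_Icc.2 hs.le)
    exact ⟨x, hx.mono (EReal.coe_lt_coe_iff.1 hts).le⟩
  · rintro ⟨x, hx⟩
    obtain ⟨b, hb, y, hy⟩ := hx.exists_extension h ht
    refine (EReal.coe_lt_coe_iff.2 hb).trans_le (le_sSup ⟨b, ⟨ht.trans_lt hb, y, ?_⟩, rfl⟩)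
    exact hy.isSolutionOn

theorem IsSol.eqOn_maximalSolution (h : IsC1With U f D) (hx : IsSol U f a φ x) (ha : 0 ≤ a) :
    EqOn (maximalSolution U f φ) x (Iic a) := by
  intro r hr
  rcases le_or_gt r 0 with h0 | h0
  · rw [maximalSolution, dif_pos h0]
    exact (seg_zero_eq_iff.1 hx.seg_zero ⟨r, h0⟩).symm
  · obtain ⟨b, hb, y, hy⟩ := hx.exists_extension h ha
    have hex : ∃ x : ℝ → EuclideanSpace ℝ (Fin n), ∃ t' : ℝ,
        r < t' ∧ (t' : EReal) < escapeTime U f φ ∧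
          IsSolutionOn U f (Icc 0 t') x ∧ historySegment x 0 = φ :=
      ⟨y, b, lt_of_le_of_lt hr hb, (lt_escapeTime_iff h (ha.trans hb.le)).2 ⟨y, hy⟩,
        hy.isSolutionOn⟩
    rw [maximalSolution, dif_neg h0.not_ge, dif_pos hex]
    obtain ⟨t', hrt', -, hz, hz0⟩ := hex.choose_spec
    have ht' : 0 ≤ t' := h0.le.trans hrt'.le
    obtain ⟨z, hz, hzz⟩ := hz.exists_isSol ordConnected_Icc (left_mem_Icc.2 ht') hz0 ht'
      (right_mem_Icc.2 ht')
    rw [hzz hrt'.le]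
    exact IsSol.eqOn h (hz.mono hrt'.le) (hx.mono hr) h0.le self_mem_Iic

theorem IsSol.flow_eq (h : IsC1With U f D) (hx : IsSol U f a φ x) (ht : 0 ≤ t) (hta : t ≤ a) :
    flow U f t φ = seg x t :=
  historySegment_eq_seg ((hx.mono hta).eqOn_maximalSolution h ht)

theorem mem_flowDomain_iff (h : IsC1With U f D) :
    (t, φ) ∈ flowDomain U f ↔ 0 ≤ t ∧ ∃ x, IsSol U f t φ x := by
  refine and_congr_right fun ht => ?_
  rw [lt_escapeTime_iff h ht]
  exact ⟨fun H => H.2, fun ⟨x, hx⟩ => ⟨hx.mem ht, x, hx⟩⟩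

theorem flowDomainAt_eq (h : IsC1With U f D) (ht : 0 ≤ t) :
    flowDomainAt U f t = {φ | ∃ x, IsSol U f t φ x} := by
  ext φ
  rw [flowDomainAt, mem_ofPred_eq, mem_flowDomain_iff h]
  exact ⟨fun H => H.2.2, fun ⟨x, hx⟩ => ⟨hx.mem ht, ht, x, hx⟩⟩

theorem zero_lt_escapeTime (h : IsC1With U f D) (hφ : φ ∈ U) : 0 < escapeTime U f φ := by
  obtain ⟨a, ha, x, hx⟩ := exists_isSol h hφ
  exact_mod_cast (lt_escapeTime_iff h le_rfl).2 ⟨x, hx.mono ha.le⟩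

theorem isSolutionOn_maximalSolution (h : IsC1With U f D) :
    IsSolutionOn U f (maximalInterval U f φ) (maximalSolution U f φ) := by
  -- near every point of the maximal interval, `x^φ` agrees with a solution on a larger interval
  have hloc : ∀ t ∈ maximalInterval U f φ, ∃ b, t < b ∧ ∃ x, IsSol U f b φ x ∧
      EqOn (maximalSolution U f φ) x (Iic b) := by
    rintro t ⟨ht, hlt⟩
    obtain ⟨x, hx⟩ := (lt_escapeTime_iff h ht).1 hlt
    obtain ⟨b, hb, y, hy⟩ := hx.exists_extension h ht
    exact ⟨b, hb, y, hy, hy.eqOn_maximalSolution h (ht.trans hb.le)⟩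
  refine ⟨?_, fun t ht => ?_⟩
  · rintro _ ⟨s, hs, t, ht, rfl⟩
    obtain ⟨b, hb, x, hx, hxm⟩ := hloc t ht
    have hsb : s + t < b := by linarith [show s ≤ 0 from hs]
    refine (x.continuous.continuousAt.congr ?_).continuousWithinAt
    filter_upwards [Iic_mem_nhds hsb] with r hr using (hxm hr).symm
  · obtain ⟨b, hb, x, hx, hxm⟩ := hloc t ht
    have htb : t ∈ Icc 0 b := ⟨ht.1, hb.le⟩
    rw [historySegment_eq_seg (hxm.mono (Iic_subset_Iic.2 hb.le))]
    refine ⟨hx.seg_mem t htb, ?_⟩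
    refine HasDerivWithinAt.mono_of_mem_nhdsWithin ((hx.hasDerivWithinAt t htb).congr
      (fun s hs => hxm hs.2) (hxm hb.le)) ?_
    filter_upwards [self_mem_nhdsWithin, nhdsWithin_le_nhds (Iic_mem_nhds hb)] with r hr hrb
    exact ⟨hr.1, hrb⟩

theorem IsSolutionOn.subset_maximalInterval (h : IsC1With U f D) {I : Set ℝ}
    {y : ℝ → EuclideanSpace ℝ (Fin n)} (hy : IsSolutionOn U f I y) (hI : I.OrdConnected)
    (h0 : IsLeast I 0) (hy0 : historySegment y 0 = φ) :
    I ⊆ maximalInterval U f φ ∧ EqOn y (maximalSolution U f φ) (Iic 0 + I) := by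
  constructor
  · intro t ht
    obtain ⟨x, hx, -⟩ := hy.exists_isSol hI h0.1 hy0 (h0.2 ht) ht
    exact ⟨h0.2 ht, (lt_escapeTime_iff h (h0.2 ht)).2 ⟨x, hx⟩⟩
  · rintro _ ⟨s, hs, t, ht, rfl⟩
    obtain ⟨x, hx, hyx⟩ := hy.exists_isSol hI h0.1 hy0 (h0.2 ht) ht
    have hst : s + t ≤ t := add_le_of_nonpos_left hs
    exact (hyx hst).trans (hx.eqOn_maximalSolution h (h0.2 ht) hst).symm

theorem historySegment_maximalSolution_zero (φ : HistorySpace n) :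
    historySegment (maximalSolution U f φ) 0 = φ := by
  rw [historySegment_eq_seg (x := constExtend φ) fun r hr => ?_, seg_constExtend]
  have hr0 : r ≤ 0 := hr
  rw [maximalSolution, dif_pos hr0]
  exact (seg_zero_eq_iff.1 (seg_constExtend φ) ⟨r, hr0⟩).symm

theorem isSemiflow_flow (h : IsC1With U f D) : IsSemiflow U (flowDomain U f) (flow U f) where
  domain_subset := fun _ hp => ⟨hp.1, hp.2.1⟩
  mapsTo := by
    intro t φ ht
    obtain ⟨ht0, x, hx⟩ := (mem_flowDomain_iff h).1 ht
    rw [hx.flow_eq h ht0 le_rfl]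
    exact hx.seg_mem t ⟨ht0, le_rfl⟩
  zero_mem := fun φ hφ => ⟨le_rfl, hφ, by exact_mod_cast zero_lt_escapeTime h hφ⟩
  zero_apply := fun φ _ => historySegment_maximalSolution_zero φ
  add := by
    intro s t φ ht hs
    obtain ⟨ht0, x, hx⟩ := (mem_flowDomain_iff h).1 ht
    rw [hx.flow_eq h ht0 le_rfl] at hs ⊢
    obtain ⟨hs0, y, hy⟩ := (mem_flowDomain_iff h).1 hs
    have hz := hx.append hy ht0 hs0
    rw [add_comm t s] at hz
    refine ⟨(mem_flowDomain_iff h).2 ⟨add_nonneg hs0 ht0, _, hz⟩, ?_⟩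
    rw [hy.flow_eq h hs0 le_rfl, hz.flow_eq h (add_nonneg hs0 ht0) le_rfl, seg_shift,
      neg_add_cancel_comm_assoc]

theorem continuousOn_flow (h : IsC1With U f D) :
    ContinuousOn (fun p : ℝ × HistorySpace n => flow U f p.1 p.2) (flowDomain U f) := by
  rintro ⟨t, φ⟩ ht
  obtain ⟨ht0, x₀, hx₀⟩ := (mem_flowDomain_iff h).1 ht
  obtain ⟨b, hb, x, hx⟩ := hx₀.exists_extension h ht0
  have hb0 := ht0.trans hb.le
  refine tendsto_iff_histSeminorm.2 fun S hS ε hε => ?_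
  have hfst : Tendsto Prod.fst (𝓝 (t, φ)) (𝓝 t) := continuous_fst.tendsto (t, φ)
  have hsnd : Tendsto Prod.snd (𝓝 (t, φ)) (𝓝 φ) := continuous_snd.tendsto (t, φ)
  filter_upwards [self_mem_nhdsWithin, nhdsWithin_le_nhds (hfst (Iio_mem_nhds hb)),
    nhdsWithin_le_nhds (hsnd (hx.eventually_exists h hb0)),
    nhdsWithin_le_nhds (hsnd (hx.eventually_near h hb0 S (half_pos hε))),
    nhdsWithin_le_nhds (hfst (tendsto_iff_histSeminorm.1 ((continuous_seg x).tendsto t) S hS _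
      (half_pos hε)))]
  rintro ⟨s, ψ⟩ hs (hsb : s < b) ⟨y, hy⟩ h1 h2
  have hs0 : 0 ≤ s := hs.1
  simp only
  rw [hy.flow_eq h hs0 hsb.le, hx.flow_eq h ht0 hb.le]
  have h3 := h1 y hy s ⟨hs0, hsb.le⟩
  have h4 : histSeminorm S (seg x s - seg x t) < ε / 2 := h2
  have h5 := map_add_le_add (histSeminorm S) (seg y s - seg x s) (seg x s - seg x t)
  rw [sub_add_sub_cancel] at h5
  linarith

end Semiflow

/-! ### The two kinds of smoothness -/

section Kinds

variable {E : Type*} [NormedAddCommGroup E] [NormedSpace ℝ E] {U : Set (History E)}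
  {f : History E → E}

theorem IsC1MBOn.exists_isC1With (hU : IsOpen U) (hf : IsC1MBOn f U) : ∃ D, IsC1With U f D := by
  obtain ⟨hc, D, hD, hDc⟩ := hf
  exact ⟨D, hU, hc, hD, hDc⟩

theorem IsC1FOn.exists_isC1With (hU : IsOpen U) (hf : IsC1FOn f U) :
    ∃ D : History E → History E →L[ℝ] E, IsC1With U f (fun u v => D u v) ∧ ContinuousOn D U := by
  obtain ⟨hc, D, hD, hDc⟩ := hf
  have _ : LocallyCompactSpace (Iic (0 : ℝ)) := isClosed_Iic.locallyCompactSpace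
  have _ : SigmaCompactSpace (Iic (0 : ℝ)) :=
    isClosed_Iic.isClosedEmbedding_subtypeVal.sigmaCompactSpace
  have _ : FirstCountableTopology (History E) := inferInstance
  exact ⟨D, ⟨hU, hc, hD, continuousOn_uncurry_of_continuousOn hDc⟩, hDc⟩

theorem IsC1On.exists_isC1With {kind : C1Kind} (hU : IsOpen U) (hf : IsC1On kind f U) :
    ∃ D, IsC1With U f D := by
  cases kind with
  | MB => exact IsC1MBOn.exists_isC1With hU hf
  | F =>
    obtain ⟨D, hD, -⟩ := IsC1FOn.exists_isC1With hU hf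
    exact ⟨_, hD⟩

/-- The solution operators inherit both kinds of smoothness. -/
theorem IsC1On.isC1On_of_isSol [CompleteSpace E] {kind : C1Kind} (hU : IsOpen U)
    (hf : IsC1On kind f U) {a : ℝ} (ha : 0 ≤ a) {Φ : History E → History E}
    (hΦ : ∀ ψ y, IsSol U f a ψ y → Φ ψ = seg y a) :
    IsC1On kind Φ {φ | ∃ x, IsSol U f a φ x} := by
  cases kind with
  | MB =>
    obtain ⟨D, hD⟩ := IsC1MBOn.exists_isC1With hU hf
    exact isC1MBOn_of_isSol hD ha hΦ
  | F =>
    obtain ⟨D, hD, hDc⟩ := IsC1FOn.exists_isC1With hU hf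
    exact isC1FOn_of_isSol hD hDc ha hΦ

end Kinds

end FrechetDDE

theorem corollary4p3 (n : ℕ) (kind : FrechetDDE.C1Kind)
    (U : Set (FrechetDDE.HistorySpace n)) (hU : IsOpen U)
    (f : FrechetDDE.HistorySpace n → EuclideanSpace ℝ (Fin n))
    (hf : FrechetDDE.IsC1On kind f U) :
    -- for every initial value in `U` there is a unique maximal solution, namely `x^φ` on `[0, t_φ)`
    (∀ φ ∈ U,
      0 < FrechetDDE.escapeTime U f φ ∧
      FrechetDDE.IsSolutionOn U f (FrechetDDE.maximalInterval U f φ)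
        (FrechetDDE.maximalSolution U f φ) ∧
      FrechetDDE.historySegment (FrechetDDE.maximalSolution U f φ) 0 = φ ∧
      ∀ (I : Set ℝ) (y : ℝ → EuclideanSpace ℝ (Fin n)),
        I.OrdConnected → I.Nontrivial → IsLeast I 0 →
        FrechetDDE.IsSolutionOn U f I y → FrechetDDE.historySegment y 0 = φ →
          I ⊆ FrechetDDE.maximalInterval U f φ ∧
          Set.EqOn y (FrechetDDE.maximalSolution U f φ) (Set.Iic 0 + I)) ∧
    -- the maximal solutions define a semiflow
    FrechetDDE.IsSemiflow U (FrechetDDE.flowDomain U f) (FrechetDDE.flow U f) ∧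
    -- the semiflow is continuous
    ContinuousOn (fun p : ℝ × FrechetDDE.HistorySpace n => FrechetDDE.flow U f p.1 p.2)
      (FrechetDDE.flowDomain U f) ∧
    -- the domains `Ω_t` are open, and the solution operators are smooth in the same sense as `f`
    ∀ t : ℝ, 0 ≤ t →
      IsOpen (FrechetDDE.flowDomainAt U f t) ∧
      FrechetDDE.IsC1On kind (FrechetDDE.flow U f t) (FrechetDDE.flowDomainAt U f t) := by
  obtain ⟨D, h⟩ := hf.exists_isC1With hU
  refine ⟨fun φ hφ => ⟨FrechetDDE.zero_lt_escapeTime h hφ,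
    FrechetDDE.isSolutionOn_maximalSolution h, FrechetDDE.historySegment_maximalSolution_zero φ,
    fun I y hI _ h0 hy hy0 => hy.subset_maximalInterval h hI h0 hy0⟩,
    FrechetDDE.isSemiflow_flow h, FrechetDDE.continuousOn_flow h, fun t ht => ?_⟩
  rw [FrechetDDE.flowDomainAt_eq h ht]
  exact ⟨FrechetDDE.isOpen_setOf_exists_isSol h ht,
    hf.isC1On_of_isSol hU ht fun ψ y hy => hy.flow_eq h ht le_rfl⟩
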